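/- Let $n\ge 1$, let $(V,\eta)$ be a real vector space of dimension $n+2$ with a symmetric bilinear form of signature $(1,n+1)$ (one negative direction), and let $p,q\in V$ be isotropic vectors with $\eta(p,q)=1$. Put $E=\{p,q\}^{\perp}$, a Euclidean space of dimension $n$. Let $SO(V)_{\mathbb{R}p}$ be the group of all $\eta$-orthogonal automorphisms of $V$ of determinant $1$ that preserve the isotropic line $\mathbb{R}p$, and let $\partial L^{n+1}$ be the set of isotropic lines of $V$ (the boundary of the Lobachevskian space $L^{n+1}$). Let $e_0=\frac{\sqrt2}{2}(p-q)$, $e_{n+1}=\frac{\sqrt2}{2}(p+q)$. Each isotropic line meets the affine hyperplane $e_0+(E\oplus\mathbb{R}e_{n+1})$ in exactly one point, which identifies $\partial L^{n+1}$ with the unit sphere of that hyperplane centred at $e_0$, and $\mathbb{R}p$ with the point $\sqrt2\,p$. Stereographic projection from $\sqrt2\,p$ onto $e_0+E\cong E$ then identifies $\partial L^{n+1}\setminus\{\mathbb{R}p\}$ with $E$, and through this bijection $SO(V)_{\mathbb{R}p}$ acts on $E$ (by similarity transformations). Let $G$ be a proper subgroup of $SO(V)_{\mathbb{R}p}$ that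 is a connected, not necessarily closed, Lie subgroup, i.e. $G$ is generated by $\exp\mathfrak{g}$ for some Lie subalgebra $\mathfrak{g}$ of $\mathfrak{gl}(V)$. Then the following are equivalent: 1. $G$ acts weakly-irreducibly on $V$, i.e. the only $G$-invariant subspaces $U\subseteq V$ for which $\eta|_U$ is nondegenerate are $U=0$ and $U=V$; 2. $G$ acts transitively on $\partial L^{n+1}\setminus\{\mathbb{R}p\}$; 3. $G$ acts transitively on $E$. -/

import Mathlib

open Module

noncomputable section

namespace Minkowski

/-- `η` is a symmetric bilinear form of signature `(1, n + 1)` (one minus sign) on a space of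
dimension `n + 2`: some basis `e₀, …, e_{n+1}` has Gram matrix `diag(-1, 1, …, 1)`. -/
def IsMinkowski {V : Type*} [AddCommGroup V] [Module ℝ V]
    (η : LinearMap.BilinForm ℝ V) (n : ℕ) : Prop :=
  ∃ e : Basis (Fin (n + 2)) ℝ V, ∀ i j,
    η (e i) (e j) = if i = j then (if i = 0 then -1 else 1) else 0

/-- The special orthogonal group `SO(V)` of `(V, η)`. -/
def SO {V : Type*} [AddCommGroup V] [Module ℝ V]
    (η : LinearMap.BilinForm ℝ V) : Subgroup (V ≃ₗ[ℝ] V) where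
  carrier := {f | (∀ x y, η (f x) (f y) = η x y) ∧ LinearEquiv.det f = 1}
  one_mem' := ⟨fun _ _ => rfl, map_one _⟩
  mul_mem' := by
    rintro f g ⟨hf, hf'⟩ ⟨hg, hg'⟩
    exact ⟨fun x y => (hf (g x) (g y)).trans (hg x y), by rw [map_mul, hf', hg', one_mul]⟩
  inv_mem' := by
    rintro f ⟨hf, hf'⟩
    refine ⟨fun x y => ?_, by rw [map_inv, hf', inv_one]⟩
    have h := hf (f⁻¹ x) (f⁻¹ y)
    rw [← LinearEquiv.mul_apply, ← LinearEquiv.mul_apply, mul_inv_cancel] at h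
    exact h.symm

/-- The image of a line (or any subspace) under a linear automorphism. -/
abbrev image {V : Type*} [AddCommGroup V] [Module ℝ V]
    (f : V ≃ₗ[ℝ] V) (l : Submodule ℝ V) : Submodule ℝ V :=
  l.map (f : V →ₗ[ℝ] V)

/-- The subgroup of `SO(V)` of the elements that preserve the line `ℝ p`. -/
def SOLine {V : Type*} [AddCommGroup V] [Module ℝ V]
    (η : LinearMap.BilinForm ℝ V) (p : V) : Subgroup (V ≃ₗ[ℝ] V) where
  carrier := {f | f ∈ SO η ∧ image f (ℝ ∙ p) = ℝ ∙ p}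
  one_mem' := ⟨one_mem _, Submodule.map_id _⟩
  mul_mem' := by
    rintro f g ⟨hf, hf'⟩ ⟨hg, hg'⟩
    refine ⟨mul_mem hf hg, ?_⟩
    have h := Submodule.map_comp (g : V →ₗ[ℝ] V) (f : V →ₗ[ℝ] V) (ℝ ∙ p)
    simp only [image] at hf' hg'
    rw [hg', hf'] at h
    exact h
  inv_mem' := by
    rintro f ⟨hf, hf'⟩
    refine ⟨inv_mem hf, ?_⟩
    have h := Submodule.map_comp (f : V →ₗ[ℝ] V) ((f⁻¹ : V ≃ₗ[ℝ] V) : V →ₗ[ℝ] V) (ℝ ∙ p)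
    simp only [image] at hf'
    rw [hf'] at h
    refine h.symm.trans ?_
    have h2 : ((f⁻¹ : V ≃ₗ[ℝ] V) : V →ₗ[ℝ] V) ∘ₗ (f : V →ₗ[ℝ] V) = LinearMap.id := by
      ext x
      exact f.symm_apply_apply x
    rw [h2, Submodule.map_id]

/-- `G` is a connected (not necessarily closed) Lie subgroup of `GL(V)`: the subgroup generated by
`exp 𝔤` for some Lie subalgebra `𝔤` of `𝔤𝔩(V)` (a linear subspace closed under
commutators). The norm on the finite-dimensional space `V` serves only to sum
the exponential series; which norm it is does not matter. -/
def IsConnectedLieSubgroup {V : Type*} [NormedAddCommGroup V] [NormedSpace ℝ V]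
    (G : Subgroup (V ≃ₗ[ℝ] V)) : Prop :=
  ∃ 𝔤 : Submodule ℝ (V →L[ℝ] V), (∀ X ∈ 𝔤, ∀ Y ∈ 𝔤, X * Y - Y * X ∈ 𝔤) ∧
    G = Subgroup.closure {g | ∃ X ∈ 𝔤, ∀ v, g v = NormedSpace.exp X v}

/-- `G` preserves no nondegenerate proper subspace of `V` (proper: neither `0` nor `V`). -/
def IsWeaklyIrreducible {V : Type*} [AddCommGroup V] [Module ℝ V]
    (η : LinearMap.BilinForm ℝ V) (G : Subgroup (V ≃ₗ[ℝ] V)) : Prop :=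
  ∀ U : Submodule ℝ V, (∀ g ∈ G, ∀ u ∈ U, g u ∈ U) → (η.restrict U).Nondegenerate →
    U = ⊥ ∨ U = ⊤

/-- The boundary of Lobachevskian space: the set of isotropic lines of `V`. -/
def boundary {V : Type*} [AddCommGroup V] [Module ℝ V]
    (η : LinearMap.BilinForm ℝ V) : Set (Submodule ℝ V) :=
  {l | finrank ℝ l = 1 ∧ ∀ x ∈ l, η x x = 0}

/-- `G` acts transitively on the set of isotropic lines other than `ℝ p`. -/
def IsTransitiveOnBoundary {V : Type*} [AddCommGroup V] [Module ℝ V]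
    (η : LinearMap.BilinForm ℝ V) (p : V) (G : Subgroup (V ≃ₗ[ℝ] V)) : Prop :=
  ∀ l ∈ boundary η \ {ℝ ∙ p}, ∀ l' ∈ boundary η \ {ℝ ∙ p}, ∃ g ∈ G, image g l = l'

/-- The Euclidean space `E`: the orthogonal complement of the plane spanned by `p` and `q`. -/
def euclid {V : Type*} [AddCommGroup V] [Module ℝ V]
    (η : LinearMap.BilinForm ℝ V) (p q : V) : Submodule ℝ V :=
  LinearMap.ker (η p) ⊓ LinearMap.ker (η q)

/-- Inverse stereographic projection. With `e₀ = (√2/2)(p - q)` and `e_{n+1} = (√2/2)(p + q)`, the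
isotropic lines are the points of the unit sphere of the hyperplane `e₀ + E ⊕ ℝ e_{n+1}` centred at
`e₀`; the line `ℝ p` is the pole `p₀ = e₀ + e_{n+1} = √2 p`. The point `Y` of `E` is sent to the
point of the sphere, other than `p₀`, on the affine line through `p₀` and `e₀ + Y`. -/
def stereoInv {V : Type*} [AddCommGroup V] [Module ℝ V]
    (η : LinearMap.BilinForm ℝ V) (p q Y : V) : V :=
  √2 • p + (2 / (1 + η Y Y)) • ((√2 / 2) • (p - q) + Y - √2 • p)

/-- `G` acts transitively on `E`, where `g` acts on `E` by the similarity transformation that is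
conjugate, under stereographic projection, to its action on the isotropic lines: `g` sends `X` to
`Y` if and only if it sends the isotropic line of `X` to that of `Y`. -/
def IsTransitiveOnEuclid {V : Type*} [AddCommGroup V] [Module ℝ V]
    (η : LinearMap.BilinForm ℝ V) (p q : V) (G : Subgroup (V ≃ₗ[ℝ] V)) : Prop :=
  ∀ X ∈ euclid η p q, ∀ Y ∈ euclid η p q,
    ∃ g ∈ G, image g (ℝ ∙ stereoInv η p q X) = ℝ ∙ stereoInv η p q Y

end Minkowski

end

/-
Every isotropic line other than `ℝ p` contains exactly one null vector `z` with `⟨p, z⟩ = 1`, so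
both transitivity statements say that `G` carries these vectors to one another, up to scalars.

Suppose that `G` is weakly irreducible. Its Lie algebra `𝔤` carries an invariant positive
semidefinite form whose radical consists of translations of `E`. Let `C = ∑ eᵢ²` be the Casimir
operator of a Parseval frame of this form, let `λ` be its eigenvalue on `p`, and let
`T = ℝ p + 𝔱 q`, where `𝔱` is the space of translations in `𝔤`. Since `C` commutes with `𝔤` up to
operators with values in `T`, the subspace `{v | (C - λ) v ∈ T}` is `𝔤`-invariant. It is not
contained in `p^⊥`: otherwise, `C` being self-adjoint, `(C - λ) k = p` for some `k ∈ p^⊥`, which is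
impossible because `λ ≥ 0` and `⟨C w, w⟩ ≤ 0` on `p^⊥`. Hence it is all of `V`, and the same sign
comparison shows that `𝔤` maps `p^⊥` into `T` and that `𝔤 p = 0` or `T = p^⊥`. In either case one
exponential joins two normalized null vectors modulo `T`, and the exponential of a translation
removes the remaining difference.

Conversely, let `G` be transitive on the lines. An invariant subspace that contains `p` and is not
contained in `p^⊥` is all of `V`. If `V = U ⊕ U^⊥` is an invariant splitting and both components of
`p` are nonzero, they span such a subspace, contradicting `dim V ≥ 3`; if one of them vanishes, the
summand containing `p` is all of `V`.
-/

namespace Minkowski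

section ParsevalFrame

variable {R L M ι : Type*} [CommRing R] [AddCommGroup L] [Module R L] [AddCommGroup M]
  [Module R M] [Fintype ι]

/-- A Parseval frame of a bilinear form `B`: a finite family `e` with `B = ∑ i, B(·, eᵢ) B(eᵢ, ·)`.
It plays the role of an orthonormal basis when `B` is allowed to be degenerate; a positive
semidefinite form has one. -/
def IsParsevalFrame (B : LinearMap.BilinForm R L) (e : ι → L) : Prop :=
  ∀ x y, B x y = ∑ i, B x (e i) * B (e i) y

variable {B : LinearMap.BilinForm R L} {e : ι → L}

theorem IsParsevalFrame.sub_sum_mem_ker (he : IsParsevalFrame B e) (x : L) :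
    x - ∑ i, B x (e i) • e i ∈ LinearMap.ker B := by
  ext y
  simp [he x y]

theorem IsParsevalFrame.apply_eq_sum (he : IsParsevalFrame B e) {f : L →ₗ[R] M}
    (hf : LinearMap.ker B ≤ LinearMap.ker f) (x : L) : f x = ∑ i, B x (e i) • f (e i) := by
  have h := hf (he.sub_sum_mem_ker x)
  rwa [LinearMap.mem_ker, map_sub, sub_eq_zero, map_sum,
    Finset.sum_congr rfl fun i _ => map_smul f (B x (e i)) (e i)] at h

/-- The tensor `∑ eᵢ ⊗ eᵢ` of a Parseval frame is killed by the skew maps of the form. -/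
theorem IsParsevalFrame.sum_skew_add_skew_eq_zero (he : IsParsevalFrame B e) (hB : B.IsSymm)
    {D : L → L} (hD : ∀ x y, B (D x) y + B x (D y) = 0) (β : L →ₗ[R] L →ₗ[R] M)
    (hl : LinearMap.ker B ≤ LinearMap.ker β) (hr : LinearMap.ker B ≤ LinearMap.ker β.flip) :
    ∑ i, (β (D (e i)) (e i) + β (e i) (D (e i))) = 0 := by
  have hleft : ∑ i, β (D (e i)) (e i) = ∑ i, ∑ j, B (D (e i)) (e j) • β (e j) (e i) := by
    refine Finset.sum_congr rfl fun i _ => ?_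
    simp [he.apply_eq_sum hl (D (e i))]
  have hright : ∑ i, β (e i) (D (e i)) = ∑ i, ∑ j, B (D (e j)) (e i) • β (e j) (e i) := by
    rw [Finset.sum_comm]
    refine Finset.sum_congr rfl fun j _ => ?_
    simpa using congrArg (fun f => f (e j)) (he.apply_eq_sum hr (D (e j)))
  rw [Finset.sum_add_distrib, hleft, hright, ← Finset.sum_add_distrib]
  refine Finset.sum_eq_zero fun i _ => ?_
  rw [← Finset.sum_add_distrib]
  refine Finset.sum_eq_zero fun j _ => ?_
  rw [← add_smul, hB.eq (D (e j)) (e i), hD, zero_smul]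

theorem exists_isParsevalFrame {L : Type*} [AddCommGroup L] [Module ℝ L] [FiniteDimensional ℝ L]
    {B : LinearMap.BilinForm ℝ L} (hB : B.IsPosSemidef) :
    ∃ (m : ℕ) (e : Fin m → L), IsParsevalFrame B e := by
  have hsymm := LinearMap.BilinForm.isSymm_iff.1 hB.isSymm
  obtain ⟨v, hv⟩ := LinearMap.BilinForm.exists_orthogonal_basis hsymm
  refine ⟨_, fun i => (√(B (v i) (v i)))⁻¹ • v i, fun x y => ?_⟩
  have hterm : ∀ x y i, B x ((√(B (v i) (v i)))⁻¹ • v i) * B ((√(B (v i) (v i)))⁻¹ • v i) y =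
      (B (v i) (v i))⁻¹ * (B x (v i) * B (v i) y) := fun x y i => by
    rw [map_smul, map_smul, LinearMap.smul_apply, smul_eq_mul, smul_eq_mul, mul_mul_mul_comm,
      ← mul_inv, Real.mul_self_sqrt (hB.nonneg (v i))]
  simp only [hterm]
  suffices h : B = ∑ i, (B (v i) (v i))⁻¹ •
      LinearMap.BilinForm.linMulLin (B.flip (v i)) (B (v i)) by
    nth_rewrite 1 [h]
    simp
  refine v.ext fun j => LinearMap.ext fun y => ?_
  have hne : ∀ i, i ≠ j → B (v j) (v i) = 0 := fun i hij => hv hij.symm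
  by_cases h0 : B (v j) (v j) = 0
  · have hj : B (v j) = 0 :=
      (LinearMap.BilinForm.apply_apply_same_eq_zero_iff B hB.nonneg hsymm).1 h0
    simp [hj]
  · simp only [LinearMap.sum_apply, LinearMap.smul_apply, LinearMap.BilinForm.linMulLin_apply,
      smul_eq_mul]
    rw [Finset.sum_eq_single j (fun i _ hij => by simp [hne i hij]) (by simp),
      LinearMap.BilinForm.flip_apply, inv_mul_cancel_left₀ h0]

end ParsevalFrame

section SelfAdjoint

variable {K V : Type*} [Field K] [AddCommGroup V] [Module K V] [FiniteDimensional K V]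
  {η : LinearMap.BilinForm K V}

theorem mem_of_forall_mem_orthogonal (hη : η.Nondegenerate) (hrefl : η.IsRefl) {T : Submodule K V}
    {v : V} (h : ∀ k ∈ η.orthogonal T, η k v = 0) : v ∈ T := by
  rw [← LinearMap.BilinForm.orthogonal_orthogonal hη hrefl T]
  exact fun k hk => h k hk

theorem orthogonal_comap_le_map_orthogonal (hη : η.Nondegenerate) (hrefl : η.IsRefl)
    {A : End K V} (hA : ∀ x y, η (A x) y = η x (A y)) (T : Submodule K V) :
    η.orthogonal (T.comap A) ≤ (η.orthogonal T).map A := by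
  rw [← LinearMap.BilinForm.orthogonal_orthogonal hη hrefl ((η.orthogonal T).map A)]
  refine LinearMap.BilinForm.orthogonal_le fun z hz => ?_
  change A z ∈ T
  refine mem_of_forall_mem_orthogonal hη hrefl fun k hk => ?_
  rw [← hA]
  exact hz _ (Submodule.mem_map_of_mem hk)

end SelfAdjoint

/-- A null pair of a Lorentzian form `η`: null vectors `p` and `q` with `η p q = 1` such that `η` is
positive definite on `{p, q}^⊥`. It gives the decomposition `V = ℝ p ⊕ E ⊕ ℝ q` without reference
to a dimension. -/
structure IsNullPair {V : Type*} [AddCommGroup V] [Module ℝ V] (η : LinearMap.BilinForm ℝ V)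
    (p q : V) : Prop where
  isSymm : η.IsSymm
  left_null : η p p = 0
  right_null : η q q = 0
  apply_eq_one : η p q = 1
  pos : ∀ w ∈ euclid η p q, w ≠ 0 → 0 < η w w

section NullPair

variable {V : Type*} [AddCommGroup V] [Module ℝ V] {η : LinearMap.BilinForm ℝ V} {p q : V}

theorem eq_zero_of_mem_span_singleton {v w : V} (hv : v ∈ ℝ ∙ p) (hw : η p w = 0) :
    η v w = 0 := by
  obtain ⟨c, rfl⟩ := Submodule.mem_span_singleton.1 hv
  simp [hw]

namespace IsNullPair

theorem comm (h : IsNullPair η p q) (x y : V) : η x y = η y x := h.isSymm.eq x y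

theorem isRefl (h : IsNullPair η p q) : η.IsRefl := h.isSymm.isRefl

theorem swap_apply_eq_one (h : IsNullPair η p q) : η q p = 1 := by
  rw [h.comm, h.apply_eq_one]

theorem sub_smul_mem_euclid (h : IsNullPair η p q) {w : V} (hw : η p w = 0) :
    w - η q w • p ∈ euclid η p q := by
  constructor
  · simp [hw, h.left_null]
  · simp [h.swap_apply_eq_one]

theorem apply_sub_smul_self (h : IsNullPair η p q) (v : V) (c : ℝ) :
    η (v - c • p) (v - c • p) = η v v - 2 * c * η p v := by
  simp only [map_sub, map_smul, LinearMap.sub_apply, LinearMap.smul_apply, smul_eq_mul,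
    h.left_null, h.comm v p]
  ring

theorem nonneg (h : IsNullPair η p q) {w : V} (hw : η p w = 0) : 0 ≤ η w w := by
  have hself := h.apply_sub_smul_self w (η q w)
  rw [hw, mul_zero, sub_zero] at hself
  rw [← hself]
  by_cases h0 : w - η q w • p = 0
  · simp [h0]
  · exact (h.pos _ (h.sub_smul_mem_euclid hw) h0).le

theorem mem_span_of_apply_self_eq_zero (h : IsNullPair η p q) {w : V} (hw : η p w = 0)
    (hww : η w w = 0) : w ∈ ℝ ∙ p := by
  have hself := h.apply_sub_smul_self w (η q w)
  rw [hw, mul_zero, sub_zero, hww] at hself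
  have h0 : w - η q w • p = 0 := by
    by_contra h0
    exact (h.pos _ (h.sub_smul_mem_euclid hw) h0).ne' hself
  exact Submodule.mem_span_singleton.2 ⟨η q w, (sub_eq_zero.1 h0).symm⟩

theorem eq_zero_of_apply_eq_zero (h : IsNullPair η p q) {x z : V} (hz : η p z ≠ 0)
    (hpx : η p x = 0) (hxx : η x x = 0) (hxz : η x z = 0) : x = 0 := by
  obtain ⟨c, rfl⟩ := Submodule.mem_span_singleton.1 (h.mem_span_of_apply_self_eq_zero hpx hxx)
  rw [map_smul, LinearMap.smul_apply, smul_eq_mul] at hxz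
  rw [(mul_eq_zero.1 hxz).resolve_right hz, zero_smul]

theorem nondegenerate (h : IsNullPair η p q) : η.Nondegenerate := by
  refine (LinearMap.IsRefl.nondegenerate_iff_separatingLeft h.isRefl).2 fun x hx => ?_
  exact h.eq_zero_of_apply_eq_zero (z := q) (by simp [h.apply_eq_one]) (by rw [h.comm, hx])
    (hx x) (hx q)

theorem restrict_nondegenerate (h : IsNullPair η p q) {U : Submodule ℝ V} (hpU : p ∈ U)
    (hU : ¬ U ≤ LinearMap.ker (η p)) : (η.restrict U).Nondegenerate := by
  obtain ⟨z, hzU, hz⟩ := SetLike.not_le_iff_exists.1 hU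
  refine LinearMap.BilinForm.nondegenerate_restrict_of_disjoint_orthogonal η h.isRefl ?_
  refine Submodule.disjoint_def.2 fun x hxU hx => ?_
  exact h.eq_zero_of_apply_eq_zero hz (hx p hpU) (hx x hxU) (by rw [h.comm]; exact hx z hzU)

section Frame

variable {ι : Type*} [Fintype ι] {f : ι → euclid η p q}

theorem eq_add_add_sum (h : IsNullPair η p q)
    (hf : IsParsevalFrame (η.restrict (euclid η p q)) f) (v : V) :
    v = η q v • p + η p v • q + ∑ i, η (f i) v • (f i : V) := by
  let w : euclid η p q := ⟨v - η q v • p - η p v • q, by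
    constructor <;> simp [h.left_null, h.right_null, h.apply_eq_one, h.swap_apply_eq_one]⟩
  have hw : w = ∑ i, η (f i) v • f i := by
    have hker : w - ∑ i, η (f i) v • f i ∈ LinearMap.ker (η.restrict (euclid η p q)) := by
      convert hf.sub_sum_mem_ker w using 5 with i
      have hp : η p (f i) = 0 := (f i).2.1
      have hq : η q (f i) = 0 := (f i).2.2
      simp [w, hp, hq, h.comm v]
    have hker_eq_bot : ∀ d ∈ LinearMap.ker (η.restrict (euclid η p q)), d = 0 := fun d hd => by
      by_contra h0
      exact (h.pos d d.2 (by simpa using h0)).ne' (LinearMap.congr_fun hd d)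
    exact sub_eq_zero.1 (hker_eq_bot _ hker)
  have hwv := congrArg (Subtype.val) hw
  rw [AddSubmonoidClass.coe_finsetSum] at hwv
  simp only [w, Submodule.coe_smul] at hwv
  rw [← hwv]
  abel

theorem trace_eq [FiniteDimensional ℝ V] (h : IsNullPair η p q)
    (hf : IsParsevalFrame (η.restrict (euclid η p q)) f) (A : End ℝ V) :
    LinearMap.trace ℝ V A = η q (A p) + η p (A q) + ∑ i, η (f i) (A (f i)) := by
  have hA : A = (η q).smulRight (A p) + (η p).smulRight (A q) +
      ∑ i, (η (f i)).smulRight (A (f i)) := by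
    ext v
    conv_lhs => rw [h.eq_add_add_sum hf v]
    simp
  conv_lhs => rw [hA]
  simp [LinearMap.trace_smulRight]

end Frame

end IsNullPair

end NullPair

section Minkowski

variable {V : Type*} [AddCommGroup V] [Module ℝ V] {η : LinearMap.BilinForm ℝ V} {n : ℕ}
  {e : Basis (Fin (n + 2)) ℝ V}

theorem apply_eq_neg_add_sum
    (he : ∀ i j, η (e i) (e j) = if i = j then (if i = 0 then -1 else 1) else 0) (x y : V) :
    η x y = -(e.repr x 0 * e.repr y 0) + ∑ i : Fin (n + 1), e.repr x i.succ * e.repr y i.succ := by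
  rw [← LinearMap.sum_repr_mul_repr_mul e e x y]
  simp [Finsupp.sum_fintype, he, Fin.sum_univ_succ, Fin.succ_ne_zero]

theorem eq_zero_of_repr_zero_eq_zero
    (he : ∀ i j, η (e i) (e j) = if i = j then (if i = 0 then -1 else 1) else 0) {x : V}
    (hx : e.repr x 0 = 0) (hxx : η x x ≤ 0) : x = 0 := by
  rw [apply_eq_neg_add_sum he, hx, mul_zero, neg_zero, zero_add] at hxx
  have hsum := (Finset.sum_nonneg fun i (_ : i ∈ Finset.univ) =>
    mul_self_nonneg (e.repr x (Fin.succ i))).antisymm hxx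
  refine e.ext_elem fun i => ?_
  rw [map_zero, Finsupp.zero_apply]
  refine Fin.cases hx (fun i => ?_) i
  exact mul_self_eq_zero.1 ((Finset.sum_eq_zero_iff_of_nonneg fun i _ => mul_self_nonneg _).1
    hsum.symm i (Finset.mem_univ i))

theorem IsMinkowski.isNullPair (hη : IsMinkowski η n) {p q : V} (hp : η p p = 0) (hq : η q q = 0)
    (hpq : η p q = 1) : IsNullPair η p q := by
  obtain ⟨e, he⟩ := hη
  have hsymm : ∀ x y, η x y = η y x := fun x y => by
    simp only [apply_eq_neg_add_sum he, mul_comm]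
  refine ⟨⟨hsymm⟩, hp, hq, hpq, fun w ⟨hpw, hqw⟩ hw0 => ?_⟩
  obtain ⟨u, huu, hwu, hpu⟩ : ∃ u, η u u = -2 ∧ η w u = 0 ∧ η p u = -1 := by
    refine ⟨p - q, ?_, ?_, by simp [hp, hpq]⟩
    · simp only [map_sub, LinearMap.sub_apply, hp, hq, hpq, hsymm q p]
      norm_num
    · rw [map_sub, hsymm w p, hsymm w q, hpw, hqw, sub_zero]
  have hu0 : e.repr u 0 ≠ 0 := fun h0 => by
    rw [eq_zero_of_repr_zero_eq_zero he h0 (by rw [huu]; norm_num), map_zero] at hpu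
    norm_num at hpu
  by_contra hww
  set c := e.repr w 0 / e.repr u 0 with hc
  have hx : w - c • u = 0 := by
    have hxx : η (w - c • u) (w - c • u) = η w w - 2 * c ^ 2 := by
      simp only [map_sub, map_smul, LinearMap.sub_apply, LinearMap.smul_apply, smul_eq_mul, huu,
        hsymm u w, hwu]
      ring
    exact eq_zero_of_repr_zero_eq_zero he (by simp [hc, hu0]) (by nlinarith [sq_nonneg c])
  have hc0 : c = 0 := by
    have hpx := congrArg (η p) hx
    rw [map_sub, map_smul, hpw, hpu] at hpx
    simpa using hpx
  rw [hc0, zero_smul, sub_zero] at hx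
  exact hw0 hx

end Minkowski

section LightCone

variable {V : Type*} [AddCommGroup V] [Module ℝ V]

/-- The null vectors normalized against `p`. Each isotropic line other than `ℝ p` contains exactly
one of them. -/
def lightConeSection (η : LinearMap.BilinForm ℝ V) (p : V) : Set V :=
  {z | η p z = 1 ∧ η z z = 0}

/-- The normalized null vector on the isotropic line that stereographic projection assigns to the
point `Y` of `E`. -/
noncomputable def lightConePoint (η : LinearMap.BilinForm ℝ V) (p q Y : V) : V :=
  q - √2 • Y - η Y Y • p

variable {η : LinearMap.BilinForm ℝ V} {p q : V}

namespace IsNullPair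

theorem eq_of_sub_mem_span (h : IsNullPair η p q) {z z' : V} (hz : z ∈ lightConeSection η p)
    (hz' : z' ∈ lightConeSection η p) (hsub : z' - z ∈ ℝ ∙ p) : z' = z := by
  obtain ⟨c, hc⟩ := Submodule.mem_span_singleton.1 hsub
  have hself := h.apply_sub_smul_self z' c
  rw [hc, sub_sub_cancel, hz.2, hz'.1, hz'.2] at hself
  have hc0 : c = 0 := by linarith
  rwa [hc0, zero_smul, eq_comm, sub_eq_zero] at hc

theorem exists_sub_smul_mem_lightConeSection (h : IsNullPair η p q) {v : V} (hv : η p v = 1) :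
    ∃ c : ℝ, v - c • p ∈ lightConeSection η p := by
  refine ⟨η v v / 2, ?_, ?_⟩
  · simp [h.left_null, hv]
  · rw [h.apply_sub_smul_self, hv]
    ring

theorem span_singleton_mem_boundary_diff (h : IsNullPair η p q) {z : V}
    (hz : z ∈ lightConeSection η p) : ℝ ∙ z ∈ boundary η \ {ℝ ∙ p} := by
  have hz0 : z ≠ 0 := by
    rintro rfl
    simpa using hz.1
  refine ⟨⟨finrank_span_singleton hz0, fun x hx => ?_⟩, fun hzp => ?_⟩
  · obtain ⟨c, rfl⟩ := Submodule.mem_span_singleton.1 hx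
    simp [hz.2]
  · have hzp' : z ∈ ℝ ∙ p := hzp ▸ Submodule.mem_span_singleton_self z
    have hpz := hz.1
    rw [h.comm, eq_zero_of_mem_span_singleton hzp' h.left_null] at hpz
    exact zero_ne_one hpz

theorem exists_span_singleton_eq (h : IsNullPair η p q) {l : Submodule ℝ V}
    (hl : l ∈ boundary η \ {ℝ ∙ p}) : ∃ z ∈ lightConeSection η p, ℝ ∙ z = l := by
  obtain ⟨⟨hfinrank, hnull⟩, hlp⟩ := hl
  have : FiniteDimensional ℝ l := FiniteDimensional.of_finrank_eq_succ hfinrank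
  obtain ⟨v, hvl, hv0⟩ := Submodule.exists_mem_ne_zero_of_ne_bot
    (Submodule.one_le_finrank_iff.1 hfinrank.ge)
  have hspan : ∀ {w}, w ∈ l → w ≠ 0 → ℝ ∙ w = l := fun hw hw0 =>
    Submodule.eq_of_le_of_finrank_eq ((Submodule.span_singleton_le_iff_mem _ _).2 hw)
      ((finrank_span_singleton hw0).trans hfinrank.symm)
  have hpv : η p v ≠ 0 := fun hpv => by
    obtain ⟨c, rfl⟩ := Submodule.mem_span_singleton.1
      (h.mem_span_of_apply_self_eq_zero hpv (hnull v hvl))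
    have hc : IsUnit c := IsUnit.mk0 c (left_ne_zero_of_smul hv0)
    exact hlp ((hspan hvl hv0).symm.trans (Submodule.span_singleton_smul_eq hc p))
  exact ⟨(η p v)⁻¹ • v, ⟨by simp [hpv], by simp [hnull v hvl]⟩,
    hspan (l.smul_mem _ hvl) (smul_ne_zero (inv_ne_zero hpv) hv0)⟩

theorem image_lightConeSection (h : IsNullPair η p q) :
    (fun z => ℝ ∙ z) '' lightConeSection η p = boundary η \ {ℝ ∙ p} := by
  ext l
  constructor
  · rintro ⟨z, hz, rfl⟩
    exact h.span_singleton_mem_boundary_diff hz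
  · exact fun hl => h.exists_span_singleton_eq hl

theorem lightConePoint_mem (h : IsNullPair η p q) {Y : V} (hY : Y ∈ euclid η p q) :
    lightConePoint η p q Y ∈ lightConeSection η p := by
  have hpY : η p Y = 0 := hY.1
  have hqY : η q Y = 0 := hY.2
  have hpw : η p (q - √2 • Y) = 1 := by simp [hpY, h.apply_eq_one]
  have hww : η (q - √2 • Y) (q - √2 • Y) = 2 * η Y Y := by
    simp only [map_sub, map_smul, LinearMap.sub_apply, LinearMap.smul_apply, smul_eq_mul,
      h.right_null, h.comm Y q, hqY]
    linear_combination η Y Y * Real.mul_self_sqrt (zero_le_two (α := ℝ))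
  refine ⟨?_, ?_⟩
  · rw [lightConePoint, map_sub, hpw, map_smul, h.left_null, smul_zero, sub_zero]
  · rw [lightConePoint, h.apply_sub_smul_self, hpw, hww]
    ring

theorem image_lightConePoint (h : IsNullPair η p q) :
    lightConePoint η p q '' euclid η p q = lightConeSection η p := by
  refine Set.Subset.antisymm (Set.image_subset_iff.2 fun Y hY => h.lightConePoint_mem hY)
    fun z hz => ?_
  have hpqz : η p (q - z) = 0 := by rw [map_sub, h.apply_eq_one, hz.1, sub_self]
  let Y : V := (√2)⁻¹ • (q - z - η q (q - z) • p)
  have hY : Y ∈ euclid η p q := Submodule.smul_mem _ _ (h.sub_smul_mem_euclid hpqz)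
  refine ⟨Y, hY, h.eq_of_sub_mem_span hz (h.lightConePoint_mem hY) ?_⟩
  refine Submodule.mem_span_singleton.2 ⟨η q (q - z) - η Y Y, ?_⟩
  rw [lightConePoint, smul_inv_smul₀ (by positivity)]
  module

theorem stereoInv_eq_smul (h : IsNullPair η p q) {Y : V} (hY : Y ∈ euclid η p q) :
    stereoInv η p q Y = (-√2 / (1 + η Y Y)) • lightConePoint η p q Y := by
  have hYY : 1 + η Y Y ≠ 0 := by linarith [h.nonneg hY.1]
  have hsqrt : √2 * √2 = 2 := Real.mul_self_sqrt zero_le_two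
  rw [stereoInv, lightConePoint]
  match_scalars
  · field_simp
    ring
  · field_simp
  · field_simp
    linarith

theorem span_stereoInv (h : IsNullPair η p q) {Y : V} (hY : Y ∈ euclid η p q) :
    ℝ ∙ stereoInv η p q Y = ℝ ∙ lightConePoint η p q Y := by
  have hYY : 1 + η Y Y ≠ 0 := by linarith [h.nonneg hY.1]
  rw [h.stereoInv_eq_smul hY]
  exact Submodule.span_singleton_smul_eq
    (IsUnit.mk0 _ (div_ne_zero (neg_ne_zero.2 (by positivity)) hYY)) _

theorem image_stereoInv (h : IsNullPair η p q) :
    (fun Y => ℝ ∙ stereoInv η p q Y) '' euclid η p q = boundary η \ {ℝ ∙ p} := by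
  rw [← h.image_lightConeSection, ← h.image_lightConePoint, Set.image_image]
  exact Set.image_congr fun Y hY => h.span_stereoInv hY

theorem isTransitiveOnBoundary_iff_isTransitiveOnEuclid (h : IsNullPair η p q)
    {G : Subgroup (V ≃ₗ[ℝ] V)} :
    IsTransitiveOnBoundary η p G ↔ IsTransitiveOnEuclid η p q G := by
  simp only [IsTransitiveOnBoundary, IsTransitiveOnEuclid, ← h.image_stereoInv,
    Set.forall_mem_image, SetLike.mem_coe]

theorem isTransitiveOnBoundary_iff (h : IsNullPair η p q) {G : Subgroup (V ≃ₗ[ℝ] V)} :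
    IsTransitiveOnBoundary η p G ↔ ∀ z ∈ lightConeSection η p, ∀ z' ∈ lightConeSection η p,
      ∃ g ∈ G, ℝ ∙ g z = ℝ ∙ z' := by
  simp only [IsTransitiveOnBoundary, ← h.image_lightConeSection, Set.forall_mem_image, image,
    LinearMap.map_span, Set.image_singleton, LinearEquiv.coe_coe]

end IsNullPair

end LightCone

section Parabolic

attribute [local instance] LieRing.ofAssociativeRing

variable {V : Type*} [AddCommGroup V] [Module ℝ V]

/-- The Lie algebra of the stabilizer of the line `ℝ p` in the orthogonal group of `η`. -/
def parabolicSubalgebra (η : LinearMap.BilinForm ℝ V) (p : V) : LieSubalgebra ℝ (End ℝ V) where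
  carrier := {X | (∀ x y, η (X x) y + η x (X y) = 0) ∧ X p ∈ ℝ ∙ p}
  zero_mem' := by simp
  add_mem' := by
    rintro X Y ⟨hX, hXp⟩ ⟨hY, hYp⟩
    refine ⟨fun x y => ?_, add_mem hXp hYp⟩
    simp only [LinearMap.add_apply, map_add]
    linarith [hX x y, hY x y]
  smul_mem' := by
    rintro c X ⟨hX, hXp⟩
    refine ⟨fun x y => ?_, Submodule.smul_mem _ c hXp⟩
    simp [← mul_add, hX x y]
  lie_mem' := by
    rintro X Y ⟨hX, hXp⟩ ⟨hY, hYp⟩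
    have hspan : ∀ {Z : End ℝ V}, Z p ∈ ℝ ∙ p → ∀ {v}, v ∈ ℝ ∙ p → Z v ∈ ℝ ∙ p := by
      intro Z hZ v hv
      obtain ⟨c, rfl⟩ := Submodule.mem_span_singleton.1 hv
      exact map_smul Z c p ▸ Submodule.smul_mem _ c hZ
    refine ⟨fun x y => ?_, sub_mem (hspan hXp hYp) (hspan hYp hXp)⟩
    simp only [LinearMap.sub_apply, Ring.lie_def, End.mul_apply, map_sub]
    linarith [hX (Y x) y, hX x (Y y), hY (X x) y, hY x (X y)]

/-- The endomorphisms that kill `p` and map `p^⊥` into `ℝ p`. In the parabolic subalgebra they are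
the infinitesimal translations of `E`. -/
def translations (η : LinearMap.BilinForm ℝ V) (p : V) : Submodule ℝ (End ℝ V) where
  carrier := {X | X p = 0 ∧ ∀ w, η p w = 0 → X w ∈ ℝ ∙ p}
  zero_mem' := by simp
  add_mem' := by
    rintro X Y ⟨hXp, hX⟩ ⟨hYp, hY⟩
    exact ⟨by simp [hXp, hYp], fun w hw => add_mem (hX w hw) (hY w hw)⟩
  smul_mem' := by
    rintro c X ⟨hXp, hX⟩
    exact ⟨by simp [hXp], fun w hw => Submodule.smul_mem _ c (hX w hw)⟩

/-- The eigenvalue of a parabolic endomorphism on `p`, for a null pair `p, q`: the infinitesimal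
dilation factor of its action on `E`. -/
def weight (η : LinearMap.BilinForm ℝ V) (p q : V) : End ℝ V →ₗ[ℝ] ℝ :=
  η q ∘ₗ LinearMap.applyₗ p

variable {η : LinearMap.BilinForm ℝ V} {p q : V} {X Y : End ℝ V}

theorem apply_eq_neg_of_mem (hX : X ∈ parabolicSubalgebra η p) (x y : V) :
    η (X x) y = -η x (X y) :=
  eq_neg_of_add_eq_zero_left (hX.1 x y)

theorem apply_orthogonal_eq_zero (hX : X ∈ parabolicSubalgebra η p) {w : V} (hw : η p w = 0) :
    η p (X w) = 0 := by
  rw [← neg_eq_zero, ← apply_eq_neg_of_mem hX, eq_zero_of_mem_span_singleton hX.2 hw]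

theorem apply_mem_span_singleton (hX : X ∈ parabolicSubalgebra η p) {v : V} (hv : v ∈ ℝ ∙ p) :
    X v ∈ ℝ ∙ p := by
  obtain ⟨c, rfl⟩ := Submodule.mem_span_singleton.1 hv
  rw [map_smul]
  exact Submodule.smul_mem _ c hX.2

theorem apply_eq_zero_of_apply_left_eq_zero (hX : X ∈ parabolicSubalgebra η p) (hXp : X p = 0)
    (v : V) : η p (X v) = 0 := by
  rw [← neg_eq_zero, ← apply_eq_neg_of_mem hX, hXp, map_zero, LinearMap.zero_apply]

theorem lie_mem_translations (hX : X ∈ parabolicSubalgebra η p) (hY : Y ∈ translations η p) :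
    ⁅X, Y⁆ ∈ translations η p := by
  have hYspan : ∀ v ∈ ℝ ∙ p, Y v = 0 := by
    intro v hv
    obtain ⟨c, rfl⟩ := Submodule.mem_span_singleton.1 hv
    simp [hY.1]
  refine ⟨?_, fun w hw => ?_⟩
  · simp [Ring.lie_def, hY.1, hYspan _ hX.2]
  · exact sub_mem (apply_mem_span_singleton hX (hY.2 w hw))
      (hY.2 _ (apply_orthogonal_eq_zero hX hw))

namespace IsNullPair

theorem apply_left_eq_weight_smul (h : IsNullPair η p q) (hX : X ∈ parabolicSubalgebra η p) :
    X p = weight η p q X • p := by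
  obtain ⟨c, hc⟩ := Submodule.mem_span_singleton.1 hX.2
  simp [weight, ← hc, h.swap_apply_eq_one]

theorem weight_lie (h : IsNullPair η p q) (hX : X ∈ parabolicSubalgebra η p)
    (hY : Y ∈ parabolicSubalgebra η p) : weight η p q ⁅X, Y⁆ = 0 := by
  change η q (X (Y p) - Y (X p)) = 0
  rw [h.apply_left_eq_weight_smul hX, h.apply_left_eq_weight_smul hY, map_smul, map_smul,
    h.apply_left_eq_weight_smul hX, h.apply_left_eq_weight_smul hY, smul_comm, sub_self, map_zero]

theorem trace_mul_self [FiniteDimensional ℝ V] (h : IsNullPair η p q)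
    (hX : X ∈ parabolicSubalgebra η p) {ι : Type*} [Fintype ι] {f : ι → euclid η p q}
    (hf : IsParsevalFrame (η.restrict (euclid η p q)) f) :
    LinearMap.trace ℝ V (X * X) = 2 * weight η p q X ^ 2 - ∑ i, η (X (f i)) (X (f i)) := by
  have hXp := h.apply_left_eq_weight_smul hX
  have hleft : η q (X (X p)) = weight η p q X ^ 2 := by
    rw [hXp, map_smul, hXp, map_smul, map_smul, h.swap_apply_eq_one]
    simp [pow_two]
  have hright : η p (X (X q)) = weight η p q X ^ 2 := by
    rw [← neg_neg (η p _), ← apply_eq_neg_of_mem hX, hXp, map_smul, LinearMap.smul_apply,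
      ← smul_neg, ← apply_eq_neg_of_mem hX, hXp, map_smul, LinearMap.smul_apply, h.apply_eq_one]
    simp [pow_two]
  have hmiddle : ∀ v, η v (X (X v)) = -η (X v) (X v) := fun v =>
    eq_neg_of_add_eq_zero_right (hX.1 v (X v))
  simp only [h.trace_eq hf, End.mul_apply, hleft, hright, hmiddle, Finset.sum_neg_distrib]
  ring

theorem mem_translations (h : IsNullPair η p q) (hX : X ∈ parabolicSubalgebra η p)
    (hXp : weight η p q X = 0) {ι : Type*} [Fintype ι] {f : ι → euclid η p q}
    (hf : IsParsevalFrame (η.restrict (euclid η p q)) f)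
    (hXf : ∀ i, η (X (f i)) (X (f i)) = 0) : X ∈ translations η p := by
  have hXp0 : X p = 0 := by rw [h.apply_left_eq_weight_smul hX, hXp, zero_smul]
  refine ⟨hXp0, fun w hw => ?_⟩
  rw [h.eq_add_add_sum hf w, hw, zero_smul, add_zero, map_add, map_smul, hXp0, smul_zero, zero_add,
    map_sum]
  refine Submodule.sum_mem _ fun i _ => ?_
  rw [map_smul]
  exact Submodule.smul_mem _ _ (h.mem_span_of_apply_self_eq_zero
    (apply_orthogonal_eq_zero hX (f i).2.1) (hXf i))

end IsNullPair

/-- The subspace `ℝ p + 𝔱 q` of `p^⊥`, where `𝔱` consists of the translations in `𝔤`: modulo `ℝ p`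
it is the space of directions in which `𝔤` translates `E`. -/
def translationSpace (η : LinearMap.BilinForm ℝ V) (p q : V) (𝔤 : LieSubalgebra ℝ (End ℝ V)) :
    Submodule ℝ V :=
  ℝ ∙ p ⊔ (𝔤.toSubmodule ⊓ translations η p).map (LinearMap.applyₗ q)

variable {𝔤 : LieSubalgebra ℝ (End ℝ V)}

theorem span_singleton_le_translationSpace : ℝ ∙ p ≤ translationSpace η p q 𝔤 :=
  le_sup_left

theorem self_mem_translationSpace : p ∈ translationSpace η p q 𝔤 :=
  span_singleton_le_translationSpace (Submodule.mem_span_singleton_self p)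

theorem exists_of_mem_translationSpace {v : V} (hv : v ∈ translationSpace η p q 𝔤) :
    ∃ c : ℝ, ∃ X ∈ 𝔤, X ∈ translations η p ∧ v = c • p + X q := by
  obtain ⟨_, ha, _, ⟨X, ⟨hX, hXt⟩, rfl⟩, rfl⟩ := Submodule.mem_sup.1 hv
  obtain ⟨c, rfl⟩ := Submodule.mem_span_singleton.1 ha
  exact ⟨c, X, hX, hXt, rfl⟩

namespace IsNullPair

theorem apply_mem_translationSpace (h : IsNullPair η p q) (hX : X ∈ 𝔤)
    (hXt : X ∈ translations η p) (v : V) : X v ∈ translationSpace η p q 𝔤 := by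
  have hv : X v = η p v • X q + X (v - η p v • q) := by simp
  rw [hv]
  refine add_mem (Submodule.smul_mem _ _ (Submodule.mem_sup_right ⟨X, ⟨hX, hXt⟩, rfl⟩))
    (span_singleton_le_translationSpace (hXt.2 _ ?_))
  simp [h.apply_eq_one]

theorem map_translationSpace (h : IsNullPair η p q) (h𝔤 : 𝔤 ≤ parabolicSubalgebra η p)
    (hY : Y ∈ 𝔤) {t : V} (ht : t ∈ translationSpace η p q 𝔤) :
    Y t ∈ translationSpace η p q 𝔤 := by
  obtain ⟨c, X, hX, hXt, rfl⟩ := exists_of_mem_translationSpace ht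
  have hYX : Y (c • p + X q) = c • Y p + (⁅Y, X⁆ q + X (Y q)) := by simp [Ring.lie_def]
  rw [hYX]
  refine add_mem (Submodule.smul_mem _ _ (span_singleton_le_translationSpace (h𝔤 hY).2))
    (add_mem ?_ (h.apply_mem_translationSpace hX hXt (Y q)))
  exact h.apply_mem_translationSpace (𝔤.lie_mem hY hX) (lie_mem_translations (h𝔤 hY) hXt) q

theorem translationSpace_le (h : IsNullPair η p q) (h𝔤 : 𝔤 ≤ parabolicSubalgebra η p) :
    translationSpace η p q 𝔤 ≤ LinearMap.ker (η p) := by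
  intro t ht
  obtain ⟨c, X, hX, hXt, rfl⟩ := exists_of_mem_translationSpace ht
  rw [LinearMap.mem_ker, map_add, map_smul, h.left_null, smul_zero, zero_add,
    apply_eq_zero_of_apply_left_eq_zero (h𝔤 hX) hXt.1]

end IsNullPair

end Parabolic

section InvariantForm

attribute [local instance] LieRing.ofAssociativeRing

variable {V : Type*} [AddCommGroup V] [Module ℝ V] {η : LinearMap.BilinForm ℝ V} {p q : V}
  {𝔤 : LieSubalgebra ℝ (End ℝ V)}

/-- An invariant symmetric form on a Lie algebra `𝔤` of parabolic endomorphisms, positive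
semidefinite with radical contained in the translations. The multiple of the squared weight has to
exceed its contribution to the trace form, which is `2`. -/
noncomputable def invariantForm (η : LinearMap.BilinForm ℝ V) (p q : V)
    (𝔤 : LieSubalgebra ℝ (End ℝ V)) : LinearMap.BilinForm ℝ 𝔤 :=
  (3 : ℝ) • LinearMap.BilinForm.linMulLin (weight η p q ∘ₗ 𝔤.toSubmodule.subtype)
    (weight η p q ∘ₗ 𝔤.toSubmodule.subtype) - LieModule.traceForm ℝ 𝔤 V

theorem invariantForm_apply (X Y : 𝔤) : invariantForm η p q 𝔤 X Y =
    3 * (weight η p q X * weight η p q Y) - LieModule.traceForm ℝ 𝔤 V X Y :=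
  rfl

namespace IsNullPair

theorem invariantForm_lie_add (h : IsNullPair η p q) (h𝔤 : 𝔤 ≤ parabolicSubalgebra η p)
    (X Y Z : 𝔤) :
    invariantForm η p q 𝔤 ⁅X, Y⁆ Z + invariantForm η p q 𝔤 Y ⁅X, Z⁆ = 0 := by
  have hY : weight η p q (⁅X, Y⁆ : 𝔤) = 0 := h.weight_lie (h𝔤 X.2) (h𝔤 Y.2)
  have hZ : weight η p q (⁅X, Z⁆ : 𝔤) = 0 := h.weight_lie (h𝔤 X.2) (h𝔤 Z.2)
  have htrace := LieModule.traceForm_apply_lie_apply' ℝ 𝔤 V X Y Z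
  rw [invariantForm_apply, invariantForm_apply, hY, hZ, htrace]
  simp

variable [FiniteDimensional ℝ V]

theorem exists_euclid_frame (h : IsNullPair η p q) :
    ∃ (m : ℕ) (f : Fin m → euclid η p q), IsParsevalFrame (η.restrict (euclid η p q)) f :=
  exists_isParsevalFrame ⟨⟨fun x y => h.comm x y⟩, ⟨fun x => h.nonneg x.2.1⟩⟩

theorem invariantForm_self (h : IsNullPair η p q) (h𝔤 : 𝔤 ≤ parabolicSubalgebra η p) {ι : Type*}
    [Fintype ι] {f : ι → euclid η p q} (hf : IsParsevalFrame (η.restrict (euclid η p q)) f)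
    (X : 𝔤) : invariantForm η p q 𝔤 X X =
      weight η p q X ^ 2 + ∑ i, η ((X : End ℝ V) (f i)) ((X : End ℝ V) (f i)) := by
  have htrace : LieModule.traceForm ℝ 𝔤 V X X = _ := h.trace_mul_self (h𝔤 X.2) hf
  rw [invariantForm_apply, htrace]
  ring

theorem isPosSemidef_invariantForm (h : IsNullPair η p q) (h𝔤 : 𝔤 ≤ parabolicSubalgebra η p) :
    (invariantForm η p q 𝔤).IsPosSemidef := by
  obtain ⟨m, f, hf⟩ := h.exists_euclid_frame
  refine ⟨⟨fun X Y => ?_⟩, ⟨fun X => ?_⟩⟩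
  · rw [invariantForm_apply, invariantForm_apply, mul_comm (weight η p q X),
      LieModule.traceForm_comm]
  · rw [h.invariantForm_self h𝔤 hf]
    exact add_nonneg (sq_nonneg _) (Finset.sum_nonneg fun i _ =>
      h.nonneg (apply_orthogonal_eq_zero (h𝔤 X.2) (f i).2.1))

theorem mem_translations_of_mem_ker (h : IsNullPair η p q) (h𝔤 : 𝔤 ≤ parabolicSubalgebra η p)
    {X : 𝔤} (hX : X ∈ LinearMap.ker (invariantForm η p q 𝔤)) :
    (X : End ℝ V) ∈ translations η p := by
  obtain ⟨m, f, hf⟩ := h.exists_euclid_frame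
  have hnonneg : ∀ i ∈ Finset.univ, 0 ≤ η ((X : End ℝ V) (f i)) ((X : End ℝ V) (f i)) :=
    fun i _ => h.nonneg (apply_orthogonal_eq_zero (h𝔤 X.2) (f i).2.1)
  have hself : invariantForm η p q 𝔤 X X = 0 := LinearMap.congr_fun hX X
  rw [h.invariantForm_self h𝔤 hf,
    add_eq_zero_iff_of_nonneg (sq_nonneg _) (Finset.sum_nonneg hnonneg)] at hself
  exact h.mem_translations (h𝔤 X.2) (pow_eq_zero_iff two_ne_zero |>.1 hself.1) hf fun i =>
    (Finset.sum_eq_zero_iff_of_nonneg hnonneg).1 hself.2 i (Finset.mem_univ i)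

end IsNullPair

end InvariantForm

section Casimir

attribute [local instance] LieRing.ofAssociativeRing

variable {V : Type*} [AddCommGroup V] [Module ℝ V] {η : LinearMap.BilinForm ℝ V} {p q : V}
  {𝔤 : LieSubalgebra ℝ (End ℝ V)} {ι : Type*} [Fintype ι] {e : ι → 𝔤}

/-- The Casimir operator `∑ eᵢ²` of a finite family `e` of elements of `𝔤`; the families of
interest are the Parseval frames of the invariant form. -/
def casimir (e : ι → 𝔤) : End ℝ V :=
  ∑ i, (e i : End ℝ V) * e i

/-- The eigenvalue of the Casimir operator on `p`. -/
def casimirWeight (η : LinearMap.BilinForm ℝ V) (p q : V) (e : ι → 𝔤) : ℝ :=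
  ∑ i, weight η p q (e i) ^ 2

theorem casimir_apply (v : V) :
    casimir e v = ∑ i, (e i : End ℝ V) ((e i : End ℝ V) v) := by
  simp [casimir]

theorem casimirWeight_nonneg : 0 ≤ casimirWeight η p q e :=
  Finset.sum_nonneg fun _ _ => sq_nonneg _

theorem casimir_apply_left (h𝔤 : 𝔤 ≤ parabolicSubalgebra η p) (x y : V) :
    η (casimir e x) y = -∑ i, η ((e i : End ℝ V) x) ((e i : End ℝ V) y) := by
  rw [casimir_apply, map_sum, LinearMap.sum_apply, ← Finset.sum_neg_distrib]
  exact Finset.sum_congr rfl fun i _ => apply_eq_neg_of_mem (h𝔤 (e i).2) _ _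

theorem casimir_apply_right (h𝔤 : 𝔤 ≤ parabolicSubalgebra η p) (x y : V) :
    η x (casimir e y) = -∑ i, η ((e i : End ℝ V) x) ((e i : End ℝ V) y) := by
  rw [casimir_apply, map_sum, ← Finset.sum_neg_distrib]
  exact Finset.sum_congr rfl fun i _ => eq_neg_of_add_eq_zero_right ((h𝔤 (e i).2).1 x _)

namespace IsNullPair

theorem casimir_apply_of_mem_span (h : IsNullPair η p q) (h𝔤 : 𝔤 ≤ parabolicSubalgebra η p)
    {v : V} (hv : v ∈ ℝ ∙ p) : casimir e v = casimirWeight η p q e • v := by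
  obtain ⟨c, rfl⟩ := Submodule.mem_span_singleton.1 hv
  have hp : ∀ i, (e i : End ℝ V) ((e i : End ℝ V) p) = weight η p q (e i) ^ 2 • p := fun i => by
    rw [h.apply_left_eq_weight_smul (h𝔤 (e i).2), map_smul,
      h.apply_left_eq_weight_smul (h𝔤 (e i).2), smul_smul, pow_two]
  rw [map_smul, casimir_apply, smul_comm, casimirWeight, Finset.sum_smul]
  simp only [hp]

/-- On `p^⊥` the form `⟨Cw, w⟩ = -∑ ⟨eᵢw, eᵢw⟩` is nonpositive, whereas the eigenvalue of `C` on `p`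
is nonnegative. -/
theorem of_casimir_apply_self (h : IsNullPair η p q) (h𝔤 : 𝔤 ≤ parabolicSubalgebra η p) {w : V}
    (hw : η p w = 0) (hCw : η (casimir e w) w = casimirWeight η p q e * η w w) :
    casimirWeight η p q e * η w w = 0 ∧ ∀ i, (e i : End ℝ V) w ∈ ℝ ∙ p := by
  have hei : ∀ i, η p ((e i : End ℝ V) w) = 0 := fun i =>
    apply_orthogonal_eq_zero (h𝔤 (e i).2) hw
  have hnonneg : ∀ i ∈ Finset.univ, 0 ≤ η ((e i : End ℝ V) w) ((e i : End ℝ V) w) :=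
    fun i _ => h.nonneg (hei i)
  have hleft := mul_nonneg (casimirWeight_nonneg (η := η) (p := p) (q := q) (e := e)) (h.nonneg hw)
  have hright := Finset.sum_nonneg hnonneg
  rw [casimir_apply_left h𝔤] at hCw
  refine ⟨by linarith, fun i => h.mem_span_of_apply_self_eq_zero (hei i) ?_⟩
  exact (Finset.sum_eq_zero_iff_of_nonneg hnonneg).1 (by linarith) i (Finset.mem_univ i)

variable [FiniteDimensional ℝ V]

theorem apply_sub_sum_mem_translations (h : IsNullPair η p q) (h𝔤 : 𝔤 ≤ parabolicSubalgebra η p)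
    (he : IsParsevalFrame (invariantForm η p q 𝔤) e) (X : 𝔤) :
    (X - ∑ i, invariantForm η p q 𝔤 X (e i) • (e i : End ℝ V)) ∈ translations η p := by
  have hX := h.mem_translations_of_mem_ker h𝔤 (he.sub_sum_mem_ker X)
  simpa using hX

theorem apply_mem_span_of_frame (h : IsNullPair η p q) (h𝔤 : 𝔤 ≤ parabolicSubalgebra η p)
    (he : IsParsevalFrame (invariantForm η p q 𝔤) e) {w : V} (hw : η p w = 0)
    (hew : ∀ i, (e i : End ℝ V) w ∈ ℝ ∙ p) {X : End ℝ V} (hX : X ∈ 𝔤) : X w ∈ ℝ ∙ p := by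
  have hsub := (h.apply_sub_sum_mem_translations h𝔤 he ⟨X, hX⟩).2 w hw
  have hsum : (∑ i, invariantForm η p q 𝔤 ⟨X, hX⟩ (e i) • (e i : End ℝ V)) w ∈ ℝ ∙ p := by
    rw [LinearMap.sum_apply]
    exact Submodule.sum_mem _ fun i _ => Submodule.smul_mem _ _ (hew i)
  simpa using add_mem hsub hsum

theorem apply_eq_zero_of_casimirWeight_eq_zero (h : IsNullPair η p q)
    (h𝔤 : 𝔤 ≤ parabolicSubalgebra η p) (he : IsParsevalFrame (invariantForm η p q 𝔤) e)
    (h0 : casimirWeight η p q e = 0) {X : End ℝ V} (hX : X ∈ 𝔤) : X p = 0 := by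
  have hweight : ∀ i, (e i : End ℝ V) p = 0 := fun i => by
    have hi := (Finset.sum_eq_zero_iff_of_nonneg fun i _ => sq_nonneg _).1 h0 i (Finset.mem_univ i)
    rw [h.apply_left_eq_weight_smul (h𝔤 (e i).2), pow_eq_zero_iff two_ne_zero |>.1 hi, zero_smul]
  simpa [hweight] using (h.apply_sub_sum_mem_translations h𝔤 he ⟨X, hX⟩).1

theorem casimir_commutator_mem (h : IsNullPair η p q) (h𝔤 : 𝔤 ≤ parabolicSubalgebra η p)
    (he : IsParsevalFrame (invariantForm η p q 𝔤) e) {X : End ℝ V} (hX : X ∈ 𝔤) (v : V) :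
    X (casimir e v) - casimir e (X v) ∈ translationSpace η p q 𝔤 := by
  set T := translationSpace η p q 𝔤
  let β : 𝔤 →ₗ[ℝ] 𝔤 →ₗ[ℝ] V ⧸ T := LinearMap.mk₂ ℝ
    (fun Y Z => T.mkQ ((Y : End ℝ V) ((Z : End ℝ V) v))) (by simp) (by simp) (by simp) (by simp)
  have hβ := he.sum_skew_add_skew_eq_zero (h.isPosSemidef_invariantForm h𝔤).isSymm
    (h.invariantForm_lie_add h𝔤 ⟨X, hX⟩) β ?_ ?_
  · rw [← Submodule.Quotient.mk_eq_zero, ← Submodule.mkQ_apply]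
    rw [← hβ, casimir_apply, casimir_apply, map_sum, ← Finset.sum_sub_distrib, map_sum]
    refine Finset.sum_congr rfl fun i _ => ?_
    simp [β, Ring.lie_def]
  · refine fun Y hY => LinearMap.ext fun Z => (Submodule.Quotient.mk_eq_zero T).2 ?_
    exact h.apply_mem_translationSpace Y.2 (h.mem_translations_of_mem_ker h𝔤 hY) _
  · refine fun Y hY => LinearMap.ext fun Z => (Submodule.Quotient.mk_eq_zero T).2 ?_
    exact h.map_translationSpace h𝔤 Z.2
      (h.apply_mem_translationSpace Y.2 (h.mem_translations_of_mem_ker h𝔤 hY) _)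

end IsNullPair

/-- The Casimir operator shifted by a scalar so as to kill `p`. -/
def shiftedCasimir (η : LinearMap.BilinForm ℝ V) (p q : V) (e : ι → 𝔤) : End ℝ V :=
  casimir e - casimirWeight η p q e • LinearMap.id

/-- `𝔤` preserves no proper subspace that contains `p` but is not contained in `p^⊥`. For an
algebra fixing the line `ℝ p` this is weak irreducibility, since such subspaces are
nondegenerate. -/
def IsTransverselyIrreducible (η : LinearMap.BilinForm ℝ V) (p : V)
    (𝔤 : LieSubalgebra ℝ (End ℝ V)) : Prop :=
  ∀ U : Submodule ℝ V, (∀ X ∈ 𝔤, ∀ u ∈ U, X u ∈ U) → p ∈ U → ¬ U ≤ LinearMap.ker (η p) → U = ⊤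

theorem shiftedCasimir_apply (v : V) :
    shiftedCasimir η p q e v = casimir e v - casimirWeight η p q e • v :=
  rfl

theorem shiftedCasimir_apply_comm (h𝔤 : 𝔤 ≤ parabolicSubalgebra η p) (x y : V) :
    η (shiftedCasimir η p q e x) y = η x (shiftedCasimir η p q e y) := by
  simp [shiftedCasimir_apply, casimir_apply_left h𝔤, casimir_apply_right h𝔤]

theorem apply_eq_zero_of_mem_orthogonal_translationSpace {k : V}
    (hk : k ∈ η.orthogonal (translationSpace η p q 𝔤)) : η p k = 0 :=
  hk p self_mem_translationSpace

namespace IsNullPair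

theorem shiftedCasimir_apply_of_mem_span (h : IsNullPair η p q)
    (h𝔤 : 𝔤 ≤ parabolicSubalgebra η p) {v : V} (hv : v ∈ ℝ ∙ p) :
    shiftedCasimir η p q e v = 0 := by
  rw [shiftedCasimir_apply, h.casimir_apply_of_mem_span h𝔤 hv, sub_self]

variable [FiniteDimensional ℝ V]

theorem of_shiftedCasimir_apply_self (h : IsNullPair η p q) (h𝔤 : 𝔤 ≤ parabolicSubalgebra η p)
    (he : IsParsevalFrame (invariantForm η p q 𝔤) e) {w : V} (hw : η p w = 0)
    (hAw : η (shiftedCasimir η p q e w) w = 0) :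
    casimirWeight η p q e * η w w = 0 ∧ ∀ X ∈ 𝔤, X w ∈ ℝ ∙ p := by
  rw [shiftedCasimir_apply, map_sub, map_smul, LinearMap.sub_apply, sub_eq_zero] at hAw
  obtain ⟨h0, hew⟩ := h.of_casimir_apply_self h𝔤 hw hAw
  exact ⟨h0, fun X hX => h.apply_mem_span_of_frame h𝔤 he hw hew hX⟩

theorem shiftedCasimir_apply_ne (h : IsNullPair η p q) (h𝔤 : 𝔤 ≤ parabolicSubalgebra η p)
    (he : IsParsevalFrame (invariantForm η p q 𝔤) e) {k : V} (hk : η p k = 0) :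
    shiftedCasimir η p q e k ≠ p := by
  intro hAk
  have hp0 : p ≠ 0 := by
    rintro rfl
    simpa using h.apply_eq_one
  obtain ⟨h0, hXk⟩ := h.of_shiftedCasimir_apply_self h𝔤 he hk (by rw [hAk, hk])
  rcases mul_eq_zero.1 h0 with hweight | hkk
  · have hCk : casimir e k = 0 := by
      rw [casimir_apply]
      refine Finset.sum_eq_zero fun i _ => ?_
      obtain ⟨c, hc⟩ := Submodule.mem_span_singleton.1 (hXk _ (e i).2)
      rw [← hc, map_smul, h.apply_eq_zero_of_casimirWeight_eq_zero h𝔤 he hweight (e i).2,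
        smul_zero]
    rw [shiftedCasimir_apply, hCk, hweight, zero_smul, sub_zero] at hAk
    exact hp0 hAk.symm
  · rw [h.shiftedCasimir_apply_of_mem_span h𝔤 (h.mem_span_of_apply_self_eq_zero hk hkk)] at hAk
    exact hp0 hAk.symm

theorem not_comap_shiftedCasimir_le (h : IsNullPair η p q) (h𝔤 : 𝔤 ≤ parabolicSubalgebra η p)
    (he : IsParsevalFrame (invariantForm η p q 𝔤) e) :
    ¬ (translationSpace η p q 𝔤).comap (shiftedCasimir η p q e) ≤ LinearMap.ker (η p) := by
  intro hle
  have hp : p ∈ η.orthogonal ((translationSpace η p q 𝔤).comap (shiftedCasimir η p q e)) :=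
    fun z hz => (h.comm z p).trans (hle hz)
  obtain ⟨k, hk, hkp⟩ := orthogonal_comap_le_map_orthogonal h.nondegenerate h.isRefl
    (shiftedCasimir_apply_comm h𝔤) _ hp
  exact h.shiftedCasimir_apply_ne h𝔤 he
    (apply_eq_zero_of_mem_orthogonal_translationSpace hk) hkp

theorem map_comap_shiftedCasimir (h : IsNullPair η p q) (h𝔤 : 𝔤 ≤ parabolicSubalgebra η p)
    (he : IsParsevalFrame (invariantForm η p q 𝔤) e) {X : End ℝ V} (hX : X ∈ 𝔤) {v : V}
    (hv : shiftedCasimir η p q e v ∈ translationSpace η p q 𝔤) :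
    shiftedCasimir η p q e (X v) ∈ translationSpace η p q 𝔤 := by
  convert sub_mem (h.map_translationSpace h𝔤 hX hv) (h.casimir_commutator_mem h𝔤 he hX v) using 1
  simp only [shiftedCasimir_apply, map_sub, map_smul]
  abel

theorem shiftedCasimir_apply_mem (h : IsNullPair η p q) (h𝔤 : 𝔤 ≤ parabolicSubalgebra η p)
    (he : IsParsevalFrame (invariantForm η p q 𝔤) e) (hirr : IsTransverselyIrreducible η p 𝔤)
    (v : V) : shiftedCasimir η p q e v ∈ translationSpace η p q 𝔤 := by
  have htop := hirr ((translationSpace η p q 𝔤).comap (shiftedCasimir η p q e))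
    (fun X hX u hu => h.map_comap_shiftedCasimir h𝔤 he hX hu)
    (by simp [h.shiftedCasimir_apply_of_mem_span h𝔤 (Submodule.mem_span_singleton_self p)])
    (h.not_comap_shiftedCasimir_le h𝔤 he)
  exact htop.ge (Submodule.mem_top (x := v))

theorem of_mem_orthogonal_translationSpace (h : IsNullPair η p q)
    (h𝔤 : 𝔤 ≤ parabolicSubalgebra η p) (he : IsParsevalFrame (invariantForm η p q 𝔤) e)
    (hirr : IsTransverselyIrreducible η p 𝔤) {k : V}
    (hk : k ∈ η.orthogonal (translationSpace η p q 𝔤)) :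
    casimirWeight η p q e * η k k = 0 ∧ ∀ X ∈ 𝔤, X k ∈ ℝ ∙ p :=
  h.of_shiftedCasimir_apply_self h𝔤 he (apply_eq_zero_of_mem_orthogonal_translationSpace hk)
    (hk _ (h.shiftedCasimir_apply_mem h𝔤 he hirr k))

end IsNullPair

end Casimir

section Sweep

attribute [local instance] LieRing.ofAssociativeRing

variable {V : Type*} [AddCommGroup V] [Module ℝ V] [FiniteDimensional ℝ V]
  {η : LinearMap.BilinForm ℝ V} {p q : V} {𝔤 : LieSubalgebra ℝ (End ℝ V)}

namespace IsNullPair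

theorem apply_mem_translationSpace_of_orthogonal (h : IsNullPair η p q)
    (h𝔤 : 𝔤 ≤ parabolicSubalgebra η p) (hirr : IsTransverselyIrreducible η p 𝔤)
    {X : End ℝ V} (hX : X ∈ 𝔤) {w : V} (hw : η p w = 0) : X w ∈ translationSpace η p q 𝔤 := by
  obtain ⟨m, e, he⟩ := exists_isParsevalFrame (h.isPosSemidef_invariantForm h𝔤)
  refine mem_of_forall_mem_orthogonal h.nondegenerate h.isRefl fun k hk => ?_
  have hXk := (h.of_mem_orthogonal_translationSpace h𝔤 he hirr hk).2 X hX
  rw [← neg_eq_zero, ← apply_eq_neg_of_mem (h𝔤 hX), eq_zero_of_mem_span_singleton hXk hw]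

theorem forall_apply_eq_zero_or_le_translationSpace (h : IsNullPair η p q)
    (h𝔤 : 𝔤 ≤ parabolicSubalgebra η p) (hirr : IsTransverselyIrreducible η p 𝔤) :
    (∀ X ∈ 𝔤, X p = 0) ∨ LinearMap.ker (η p) ≤ translationSpace η p q 𝔤 := by
  obtain ⟨m, e, he⟩ := exists_isParsevalFrame (h.isPosSemidef_invariantForm h𝔤)
  refine (eq_or_ne (casimirWeight η p q e) 0).imp
    (fun h0 X hX => h.apply_eq_zero_of_casimirWeight_eq_zero h𝔤 he h0 hX) fun h0 w hw => ?_
  refine mem_of_forall_mem_orthogonal h.nondegenerate h.isRefl fun k hk => ?_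
  have hkk := (mul_eq_zero.1 (h.of_mem_orthogonal_translationSpace h𝔤 he hirr hk).1).resolve_left h0
  exact eq_zero_of_mem_span_singleton (h.mem_span_of_apply_self_eq_zero
    (apply_eq_zero_of_mem_orthogonal_translationSpace hk) hkk) hw

theorem exists_sub_apply_mem_translationSpace (h : IsNullPair η p q)
    (h𝔤 : 𝔤 ≤ parabolicSubalgebra η p) (hirr : IsTransverselyIrreducible η p 𝔤)
    (hp : ∀ X ∈ 𝔤, X p = 0) {v : V} (hv : η p v = 0) :
    ∃ Y ∈ 𝔤, v - Y q ∈ translationSpace η p q 𝔤 := by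
  let N : Submodule ℝ V := translationSpace η p q 𝔤 ⊔ 𝔤.toSubmodule.map (LinearMap.applyₗ q)
  have hN : N ≤ LinearMap.ker (η p) := by
    refine sup_le (h.translationSpace_le h𝔤) ?_
    rintro _ ⟨X, hX, rfl⟩
    exact apply_eq_zero_of_apply_left_eq_zero (h𝔤 hX) (hp X hX) q
  have htop : N ⊔ ℝ ∙ q = ⊤ := by
    refine hirr _ (fun X hX u hu => Submodule.mem_sup_left ?_)
      (Submodule.mem_sup_left (Submodule.mem_sup_left self_mem_translationSpace)) fun hle => ?_
    · obtain ⟨n, hn, s, hs, rfl⟩ := Submodule.mem_sup.1 hu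
      obtain ⟨c, rfl⟩ := Submodule.mem_span_singleton.1 hs
      rw [map_add, map_smul]
      exact add_mem
        (Submodule.mem_sup_left (h.apply_mem_translationSpace_of_orthogonal h𝔤 hirr hX (hN hn)))
        (Submodule.smul_mem _ _ (Submodule.mem_sup_right ⟨X, hX, rfl⟩))
    · have hq := hle (Submodule.mem_sup_right (Submodule.mem_span_singleton_self q))
      simp [h.apply_eq_one] at hq
  obtain ⟨n, hn, s, hs, rfl⟩ := Submodule.mem_sup.1 (htop.ge (Submodule.mem_top (x := v)))
  obtain ⟨c, rfl⟩ := Submodule.mem_span_singleton.1 hs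
  have hc : c = 0 := by simpa [LinearMap.mem_ker.1 (hN hn), h.apply_eq_one] using hv
  obtain ⟨t, ht, _, ⟨Y, hY, rfl⟩, rfl⟩ := Submodule.mem_sup.1 hn
  exact ⟨Y, hY, by simpa [hc] using ht⟩

theorem exists_sub_sub_apply_mem_translationSpace (h : IsNullPair η p q)
    (h𝔤 : 𝔤 ≤ parabolicSubalgebra η p) (hirr : IsTransverselyIrreducible η p 𝔤) {z z' : V}
    (hz : η p z = 1) (hz' : η p z' = 1) :
    ∃ Y ∈ 𝔤, z' - z - Y z ∈ translationSpace η p q 𝔤 ∧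
      Y (Y z) ∈ translationSpace η p q 𝔤 := by
  have hsub : η p (z' - z) = 0 := by simp [hz, hz']
  rcases h.forall_apply_eq_zero_or_le_translationSpace h𝔤 hirr with hp | hle
  · obtain ⟨Y, hY, hYq⟩ := h.exists_sub_apply_mem_translationSpace h𝔤 hirr hp hsub
    refine ⟨Y, hY, ?_, h.apply_mem_translationSpace_of_orthogonal h𝔤 hirr hY
      (apply_eq_zero_of_apply_left_eq_zero (h𝔤 hY) (hp Y hY) z)⟩
    have hYz : Y (z - q) ∈ translationSpace η p q 𝔤 :=
      h.apply_mem_translationSpace_of_orthogonal h𝔤 hirr hY (by simp [hz, h.apply_eq_one])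
    simpa using sub_mem hYq hYz
  · exact ⟨0, zero_mem _, by simpa using hle hsub, by simp⟩

end IsNullPair

end Sweep

section Exponential

attribute [local instance] LieRing.ofAssociativeRing

variable {V : Type*} [NormedAddCommGroup V] [NormedSpace ℝ V] [FiniteDimensional ℝ V]

theorem isUnit_exp_toContinuousLinearMap (X : End ℝ V) :
    IsUnit (NormedSpace.exp (LinearMap.toContinuousLinearMap X)) :=
  have : CompleteSpace V := FiniteDimensional.complete ℝ V
  let _ : NormedAlgebra ℚ (V →L[ℝ] V) := NormedAlgebra.restrictScalars ℚ ℝ _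
  NormedSpace.isUnit_exp _

/-- The exponential of an endomorphism of a finite-dimensional space, as an element of `GL(V)`. -/
noncomputable def expEquiv (X : End ℝ V) : V ≃ₗ[ℝ] V :=
  (ContinuousLinearEquiv.unitsEquiv ℝ V (isUnit_exp_toContinuousLinearMap X).unit).toLinearEquiv

theorem expEquiv_apply (X : End ℝ V) (v : V) :
    expEquiv X v = NormedSpace.exp (LinearMap.toContinuousLinearMap X) v :=
  rfl

theorem expEquiv_zero_apply (v : V) : expEquiv (0 : End ℝ V) v = v := by
  simp [expEquiv_apply]

theorem hasSum_expEquiv_apply (X : End ℝ V) (v : V) :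
    HasSum (fun m : ℕ => (m.factorial : ℝ)⁻¹ • (X ^ m) v) (expEquiv X v) := by
  have : CompleteSpace V := FiniteDimensional.complete ℝ V
  have hsum := (NormedSpace.exp_series_hasSum_exp' (𝕂 := ℝ)
    (LinearMap.toContinuousLinearMap X)).mapL (ContinuousLinearMap.apply ℝ V v)
  have hpow : ∀ m : ℕ, (LinearMap.toContinuousLinearMap X) ^ m =
    LinearMap.toContinuousLinearMap (X ^ m) := fun m =>
      (map_pow (Module.End.toContinuousLinearMap V) X m).symm
  simpa [hpow, expEquiv_apply] using hsum

theorem expEquiv_apply_sub_sum_mem {X : End ℝ V} {S : Submodule ℝ V} {v : V} {k : ℕ}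
    (hX : ∀ m, k ≤ m → (X ^ m) v ∈ S) :
    expEquiv X v - ∑ m ∈ Finset.range k, (m.factorial : ℝ)⁻¹ • (X ^ m) v ∈ S :=
  S.closed_of_finiteDimensional.mem_of_tendsto
    ((hasSum_nat_add_iff' k).2 (hasSum_expEquiv_apply X v)) <| .of_forall fun _ =>
      Submodule.sum_mem _ fun _ _ => Submodule.smul_mem _ _ (hX _ (Nat.le_add_left k _))

theorem expEquiv_apply_mem {X : End ℝ V} {S : Submodule ℝ V} (hS : ∀ v ∈ S, X v ∈ S) {v : V}
    (hv : v ∈ S) : expEquiv X v ∈ S := by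
  have hpow : ∀ m : ℕ, (X ^ m) v ∈ S := fun m => by
    induction m with
    | zero => exact hv
    | succ m ih => rw [pow_succ']; exact hS _ ih
  simpa using expEquiv_apply_sub_sum_mem (k := 0) fun m _ => hpow m

theorem expEquiv_apply_sub_sub_mem {X : End ℝ V} {S : Submodule ℝ V} (hS : ∀ v ∈ S, X v ∈ S)
    {v : V} (hv : X (X v) ∈ S) : expEquiv X v - v - X v ∈ S := by
  have hpow : ∀ m : ℕ, 2 ≤ m → (X ^ m) v ∈ S := fun m hm => by
    induction m, hm using Nat.le_induction with
    | base => exact hv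
    | succ m _ ih => rw [pow_succ']; exact hS _ ih
  simpa [Finset.sum_range_succ, sub_sub] using expEquiv_apply_sub_sum_mem hpow

theorem hasDerivAt_expEquiv_smul_apply (X : End ℝ V) (v : V) :
    HasDerivAt (fun t : ℝ => expEquiv (t • X) v) (X v) 0 := by
  have : CompleteSpace V := FiniteDimensional.complete ℝ V
  have hderiv := (hasDerivAt_exp_smul_const (𝕂 := ℝ) (LinearMap.toContinuousLinearMap X)
    0).clm_apply (hasDerivAt_const (0 : ℝ) v)
  simpa [expEquiv_apply] using hderiv

theorem IsConnectedLieSubgroup.exists_lieSubalgebra {G : Subgroup (V ≃ₗ[ℝ] V)}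
    (hG : IsConnectedLieSubgroup G) :
    ∃ 𝔤 : LieSubalgebra ℝ (End ℝ V), G = Subgroup.closure (expEquiv '' 𝔤) := by
  obtain ⟨𝔥, h𝔥, rfl⟩ := hG
  refine ⟨{ 𝔥.comap (LinearMap.toContinuousLinearMap (𝕜 := ℝ) (E := V) (F' := V)).toLinearMap with
    lie_mem' := fun hX hY => h𝔥 _ hX _ hY }, congrArg Subgroup.closure (Set.ext fun g => ?_)⟩
  constructor
  · rintro ⟨X, hX, hg⟩
    exact ⟨X, hX, LinearEquiv.ext fun v => (hg v).symm⟩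
  · rintro ⟨X, hX, rfl⟩
    exact ⟨LinearMap.toContinuousLinearMap X, hX, fun v => rfl⟩

theorem apply_mem_of_mem_closure_expEquiv {𝔤 : LieSubalgebra ℝ (End ℝ V)} {U : Submodule ℝ V}
    (hU : ∀ X ∈ 𝔤, ∀ u ∈ U, X u ∈ U) {g : V ≃ₗ[ℝ] V}
    (hg : g ∈ Subgroup.closure (expEquiv '' (𝔤 : Set (End ℝ V)))) : ∀ u ∈ U, g u ∈ U := by
  induction hg using Subgroup.closure_induction with
  | mem g hg =>
    obtain ⟨X, hX, rfl⟩ := hg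
    exact fun u => expEquiv_apply_mem (hU X hX)
  | one => exact fun u hu => hu
  | mul _ g' _ _ hg hg' => exact fun u hu => hg _ (hg' u hu)
  | inv g _ hg =>
    have hmap : U.map (g : V →ₗ[ℝ] V) = U := Submodule.eq_of_le_of_finrank_eq
      (Submodule.map_le_iff_le_comap.2 hg) (LinearEquiv.finrank_map_eq g U)
    intro u hu
    rw [← hmap] at hu
    obtain ⟨u', hu', rfl⟩ := hu
    exact (g.symm_apply_apply u').symm ▸ hu'

theorem le_parabolicSubalgebra_of_closure_expEquiv_le {η : LinearMap.BilinForm ℝ V} {p : V}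
    {𝔤 : LieSubalgebra ℝ (End ℝ V)} (hle : Subgroup.closure (expEquiv '' 𝔤) ≤ SOLine η p) :
    𝔤 ≤ parabolicSubalgebra η p := by
  intro X hX
  have hexp : ∀ t : ℝ, expEquiv (t • X) ∈ SOLine η p := fun t =>
    hle (Subgroup.subset_closure ⟨t • X, 𝔤.smul_mem t hX, rfl⟩)
  have hp : ∀ t : ℝ, expEquiv (t • X) p ∈ ℝ ∙ p := fun t =>
    (hexp t).2 ▸ Submodule.mem_map_of_mem (Submodule.mem_span_singleton_self p)
  refine ⟨fun x y => ?_, ?_⟩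
  · have hderiv := (η.toContinuousBilinearMap.hasFDerivAt.comp_hasDerivAt (0 : ℝ)
      (hasDerivAt_expEquiv_smul_apply X x)).clm_apply (hasDerivAt_expEquiv_smul_apply X y)
    have hconst : (fun t : ℝ => η.toContinuousBilinearMap (expEquiv (t • X) x)
        (expEquiv (t • X) y)) = fun _ => η x y := funext fun t => (hexp t).1.1 x y
    simp only [Function.comp_apply] at hderiv
    rw [hconst] at hderiv
    simpa [expEquiv_zero_apply] using hderiv.unique (hasDerivAt_const (0 : ℝ) (η x y))
  · refine (ℝ ∙ p).closed_of_finiteDimensional.mem_of_tendsto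
      (hasDerivAt_iff_tendsto_slope.1 (hasDerivAt_expEquiv_smul_apply X p)) (.of_forall fun t => ?_)
    rw [slope_def_module]
    exact Submodule.smul_mem _ _ (sub_mem (hp t) (hp 0))

end Exponential

section WeaklyIrreducible

attribute [local instance] LieRing.ofAssociativeRing

variable {V : Type*} [NormedAddCommGroup V] [NormedSpace ℝ V] [FiniteDimensional ℝ V]
  {η : LinearMap.BilinForm ℝ V} {p q : V} {𝔤 : LieSubalgebra ℝ (End ℝ V)}

theorem IsWeaklyIrreducible.isTransverselyIrreducible
    (hG : IsWeaklyIrreducible η (Subgroup.closure (expEquiv '' 𝔤))) (h : IsNullPair η p q) :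
    IsTransverselyIrreducible η p 𝔤 := by
  intro U hU hpU hle
  refine (hG U (fun g hg => apply_mem_of_mem_closure_expEquiv hU hg)
    (h.restrict_nondegenerate hpU hle)).resolve_left ?_
  rintro rfl
  exact hle bot_le

namespace IsNullPair

theorem exists_sub_expEquiv_apply_mem_translationSpace (h : IsNullPair η p q)
    (h𝔤 : 𝔤 ≤ parabolicSubalgebra η p) (hirr : IsTransverselyIrreducible η p 𝔤) {z z' : V}
    (hz : η p z = 1) (hz' : η p z' = 1) :
    ∃ Y ∈ 𝔤, z' - expEquiv Y z ∈ translationSpace η p q 𝔤 := by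
  obtain ⟨Y, hY, hYz, hYYz⟩ := h.exists_sub_sub_apply_mem_translationSpace h𝔤 hirr hz hz'
  refine ⟨Y, hY, ?_⟩
  have hexp := expEquiv_apply_sub_sub_mem (fun t ht => h.map_translationSpace h𝔤 hY ht) hYYz
  convert sub_mem hYz hexp using 1
  abel

theorem exists_sub_expEquiv_apply_mem_span (h : IsNullPair η p q)
    (h𝔤 : 𝔤 ≤ parabolicSubalgebra η p) {z z' : V} (hz : η p z = 1)
    (hsub : z' - z ∈ translationSpace η p q 𝔤) : ∃ X ∈ 𝔤, z' - expEquiv X z ∈ ℝ ∙ p := by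
  obtain ⟨c, X, hX, hXt, hcX⟩ := exists_of_mem_translationSpace hsub
  have hspan : ∀ v ∈ ℝ ∙ p, X v ∈ ℝ ∙ p := fun v hv => apply_mem_span_singleton (h𝔤 hX) hv
  have hexp := expEquiv_apply_sub_sub_mem hspan
    (hXt.2 _ (apply_eq_zero_of_apply_left_eq_zero (h𝔤 hX) hXt.1 z))
  have hXzq : X (z - q) ∈ ℝ ∙ p := hXt.2 _ (by simp [hz, h.apply_eq_one])
  refine ⟨X, hX, ?_⟩
  have hz'X : z' - expEquiv X z = c • p - X (z - q) - (expEquiv X z - z - X z) := by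
    rw [map_sub, sub_eq_iff_eq_add.1 hcX]
    abel
  rw [hz'X]
  exact sub_mem (sub_mem (Submodule.smul_mem _ c (Submodule.mem_span_singleton_self p)) hXzq) hexp

end IsNullPair

theorem IsWeaklyIrreducible.exists_apply_eq {G : Subgroup (V ≃ₗ[ℝ] V)}
    (hG : IsWeaklyIrreducible η G) (h : IsNullPair η p q) (hle : G ≤ SOLine η p)
    (hconn : IsConnectedLieSubgroup G) {z z' : V} (hz : z ∈ lightConeSection η p)
    (hz' : z' ∈ lightConeSection η p) : ∃ g ∈ G, g z = z' := by
  obtain ⟨𝔤, rfl⟩ := hconn.exists_lieSubalgebra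
  have h𝔤 := le_parabolicSubalgebra_of_closure_expEquiv_le hle
  obtain ⟨Y, hY, hYz⟩ := h.exists_sub_expEquiv_apply_mem_translationSpace h𝔤
    (hG.isTransverselyIrreducible h) hz.1 hz'.1
  have hpYz : η p (expEquiv Y z) = 1 := by
    have hker := LinearMap.mem_ker.1 (h.translationSpace_le h𝔤 hYz)
    rwa [map_sub, hz'.1, sub_eq_zero, eq_comm] at hker
  obtain ⟨X, hX, hXYz⟩ := h.exists_sub_expEquiv_apply_mem_span h𝔤 hpYz hYz
  have hXY : expEquiv X * expEquiv Y ∈ Subgroup.closure (expEquiv '' (𝔤 : Set (End ℝ V))) :=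
    mul_mem (Subgroup.subset_closure ⟨X, hX, rfl⟩) (Subgroup.subset_closure ⟨Y, hY, rfl⟩)
  refine ⟨_, hXY, (h.eq_of_sub_mem_span ⟨?_, ?_⟩ hz' hXYz).symm⟩
  · have hker := eq_zero_of_mem_span_singleton hXYz h.left_null
    rw [h.comm, map_sub, hz'.1, sub_eq_zero] at hker
    exact hker.symm
  · exact ((hle hXY).1.1 z z).trans hz.2

end WeaklyIrreducible

section Transitive

variable {V : Type*} [AddCommGroup V] [Module ℝ V] {η : LinearMap.BilinForm ℝ V} {p q : V}
  {G : Subgroup (V ≃ₗ[ℝ] V)} {U U' : Submodule ℝ V}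

namespace IsTransitiveOnBoundary

theorem eq_top (hG : IsTransitiveOnBoundary η p G) (h : IsNullPair η p q)
    (hU : ∀ g ∈ G, ∀ u ∈ U, g u ∈ U) (hpU : p ∈ U) (hle : ¬ U ≤ LinearMap.ker (η p)) : U = ⊤ := by
  obtain ⟨u, hu, hpu⟩ := SetLike.not_le_iff_exists.1 hle
  have hpu1 : η p ((η p u)⁻¹ • u) = 1 := by
    rw [map_smul, smul_eq_mul, inv_mul_cancel₀ hpu]
  obtain ⟨c, hc⟩ := h.exists_sub_smul_mem_lightConeSection hpu1
  have hcone : ∀ z ∈ lightConeSection η p, z ∈ U := fun z hz => by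
    obtain ⟨g, hg, hgz⟩ := h.isTransitiveOnBoundary_iff.1 hG _ hc z hz
    rw [← Submodule.span_singleton_le_iff_mem, ← hgz, Submodule.span_singleton_le_iff_mem]
    exact hU g hg _ (U.sub_mem (U.smul_mem _ hu) (U.smul_mem _ hpU))
  have hone : ∀ v, η p v = 1 → v ∈ U := fun v hv => by
    obtain ⟨d, hd⟩ := h.exists_sub_smul_mem_lightConeSection hv
    exact (U.sub_mem_iff_left (U.smul_mem d hpU)).1 (hcone _ hd)
  refine (Submodule.eq_top_iff').2 fun v => ?_
  have hq : q ∈ U := hone q h.apply_eq_one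
  refine (U.add_mem_iff_left (U.smul_mem (1 - η p v) hq)).1 (hone _ ?_)
  simp [h.apply_eq_one]

theorem eq_top_of_codisjoint (hG : IsTransitiveOnBoundary η p G) (h : IsNullPair η p q)
    (hU : ∀ g ∈ G, ∀ u ∈ U, g u ∈ U) (hpU : p ∈ U) (hUU' : Codisjoint U U')
    (hU' : U' ≤ LinearMap.ker (η p)) : U = ⊤ := by
  refine hG.eq_top h hU hpU fun hle => ?_
  have hq := hUU' hle hU' (Submodule.mem_top (x := q))
  rw [LinearMap.mem_ker, h.apply_eq_one] at hq
  exact one_ne_zero hq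

end IsTransitiveOnBoundary

theorem apply_mem_span_singleton_of_disjoint {K M : Type*} [Ring K] [AddCommGroup M]
    [Module K M] {U U' : Submodule K M} (hUU' : Disjoint U U') {A : End K M}
    (hU : ∀ u ∈ U, A u ∈ U) (hU' : ∀ u' ∈ U', A u' ∈ U') {u u' : M} (hu : u ∈ U) (hu' : u' ∈ U')
    (hA : A (u + u') ∈ K ∙ (u + u')) : A u ∈ K ∙ u ∧ A u' ∈ K ∙ u' := by
  obtain ⟨c, hc⟩ := Submodule.mem_span_singleton.1 hA
  rw [map_add, smul_add] at hc
  have hAu := Submodule.sub_mem U (U.smul_mem c hu) (hU u hu)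
  have hAu' := Submodule.sub_mem U' (hU' u' hu') (U'.smul_mem c hu')
  have hsub : c • u - A u = A u' - c • u' := by
    rw [sub_eq_sub_iff_add_eq_add, hc, add_comm]
  have hzero : c • u - A u = 0 := Submodule.disjoint_def.1 hUU' _ hAu (hsub ▸ hAu')
  rw [hzero, eq_comm] at hsub
  exact ⟨Submodule.mem_span_singleton.2 ⟨c, sub_eq_zero.1 hzero⟩,
    Submodule.mem_span_singleton.2 ⟨c, (sub_eq_zero.1 hsub).symm⟩⟩

theorem apply_mem_orthogonal (hG : G ≤ SOLine η p) (hU : ∀ g ∈ G, ∀ u ∈ U, g u ∈ U)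
    {g : V ≃ₗ[ℝ] V} (hg : g ∈ G) {k : V} (hk : k ∈ η.orthogonal U) : g k ∈ η.orthogonal U := by
  intro u hu
  have hgk := (hG (inv_mem hg)).1.1 u (g k)
  have hinv : g⁻¹ (g k) = k := g.symm_apply_apply k
  rw [hinv, show η (g⁻¹ u) k = 0 from hk _ (hU _ (inv_mem hg) u hu)] at hgk
  exact hgk.symm

theorem IsNullPair.not_span_pair_le (h : IsNullPair η p q) (hUU' : Disjoint U U')
    (hort : ∀ u ∈ U, ∀ u' ∈ U', η u u' = 0) {u u' : V} (hu : u ∈ U) (hu' : u' ∈ U') (hu0 : u ≠ 0)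
    (hu'0 : u' ≠ 0) (hp : u + u' = p) : ¬ ℝ ∙ u ⊔ ℝ ∙ u' ≤ LinearMap.ker (η p) := by
  intro hle
  have hpu : η p u = 0 := hle (Submodule.mem_sup_left (Submodule.mem_span_singleton_self u))
  have huu : η u u = 0 := by
    rwa [← hp, map_add, LinearMap.add_apply, h.comm u', hort u hu u' hu', add_zero] at hpu
  obtain ⟨c, hc⟩ := Submodule.mem_span_singleton.1 (h.mem_span_of_apply_self_eq_zero hpu huu)
  have hc0 : c ≠ 0 := by
    rintro rfl
    exact hu0 (by rw [← hc, zero_smul])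
  have hpU : p ∈ U := (U.smul_mem_iff hc0).1 (hc ▸ hu)
  have hu'U : u' ∈ U := (U.add_mem_iff_right hu).1 (hp ▸ hpU)
  exact hu'0 (Submodule.disjoint_def.1 hUU' u' hu'U hu')

namespace IsTransitiveOnBoundary

/-- If `p` had nonzero components in both summands, these would span an invariant plane through
`p`, which transitivity forces to be all of `V`. -/
theorem eq_zero_or_eq_zero (hG : IsTransitiveOnBoundary η p G) (h : IsNullPair η p q)
    (hle : G ≤ SOLine η p) (hdim : 3 ≤ finrank ℝ V) (hU : ∀ g ∈ G, ∀ u ∈ U, g u ∈ U)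
    (hU' : ∀ g ∈ G, ∀ u' ∈ U', g u' ∈ U') (hUU' : Disjoint U U')
    (hort : ∀ u ∈ U, ∀ u' ∈ U', η u u' = 0) {u u' : V} (hu : u ∈ U) (hu' : u' ∈ U')
    (hp : u + u' = p) : u = 0 ∨ u' = 0 := by
  by_contra! h0
  have hinv : ∀ g ∈ G, ∀ w ∈ ℝ ∙ u ⊔ ℝ ∙ u', g w ∈ ℝ ∙ u ⊔ ℝ ∙ u' := fun g hg w hw => by
    have hgp : g (u + u') ∈ ℝ ∙ (u + u') := by
      rw [hp, ← (hle hg).2]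
      exact Submodule.mem_map_of_mem (Submodule.mem_span_singleton_self p)
    obtain ⟨hgu, hgu'⟩ := apply_mem_span_singleton_of_disjoint (A := g.toLinearMap) hUU'
      (hU g hg) (hU' g hg) hu hu' hgp
    obtain ⟨_, hv, _, hv', rfl⟩ := Submodule.mem_sup.1 hw
    obtain ⟨c, rfl⟩ := Submodule.mem_span_singleton.1 hv
    obtain ⟨c', rfl⟩ := Submodule.mem_span_singleton.1 hv'
    rw [map_add, map_smul, map_smul]
    exact Submodule.add_mem_sup (Submodule.smul_mem _ c hgu) (Submodule.smul_mem _ c' hgu')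
  have hmem : p ∈ ℝ ∙ u ⊔ ℝ ∙ u' := hp ▸ Submodule.add_mem_sup
    (Submodule.mem_span_singleton_self u) (Submodule.mem_span_singleton_self u')
  have htop := hG.eq_top h hinv hmem (h.not_span_pair_le hUU' hort hu hu' h0.1 h0.2 hp)
  have hfinrank := Submodule.finrank_add_le_finrank_add_finrank (ℝ ∙ u) (ℝ ∙ u')
  rw [htop, finrank_top, finrank_span_singleton h0.1, finrank_span_singleton h0.2] at hfinrank
  omega

theorem isWeaklyIrreducible [FiniteDimensional ℝ V] (hG : IsTransitiveOnBoundary η p G)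
    (h : IsNullPair η p q) (hle : G ≤ SOLine η p) (hdim : 3 ≤ finrank ℝ V) :
    IsWeaklyIrreducible η G := by
  intro U hU hnondeg
  have hcompl := LinearMap.BilinForm.isCompl_orthogonal_of_restrict_nondegenerate h.isRefl hnondeg
  have hU' : ∀ g ∈ G, ∀ k ∈ η.orthogonal U, g k ∈ η.orthogonal U := fun g hg k hk =>
    apply_mem_orthogonal hle hU hg hk
  obtain ⟨u, hu, u', hu', hp⟩ := Submodule.mem_sup.1
    (hcompl.sup_eq_top.ge (Submodule.mem_top (x := p)))
  rcases hG.eq_zero_or_eq_zero h hle hdim hU hU' hcompl.disjoint (fun u hu k hk => hk u hu)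
    hu hu' hp with rfl | rfl
  · left
    rw [zero_add] at hp
    subst hp
    have htop := hG.eq_top_of_codisjoint h hU' hu' hcompl.codisjoint.symm fun u hu =>
      (h.comm _ u).trans (hu' u hu)
    rw [htop] at hcompl
    exact eq_bot_of_isCompl_top hcompl
  · right
    rw [add_zero] at hp
    subst hp
    exact hG.eq_top_of_codisjoint h hU hu hcompl.codisjoint fun k hk => hk _ hu

end IsTransitiveOnBoundary

end Transitive

theorem isWeaklyIrreducible_iff_isTransitiveOnBoundary {V : Type*} [NormedAddCommGroup V]
    [NormedSpace ℝ V] [FiniteDimensional ℝ V] {η : LinearMap.BilinForm ℝ V} {p q : V}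
    (h : IsNullPair η p q) (hdim : 3 ≤ finrank ℝ V) {G : Subgroup (V ≃ₗ[ℝ] V)}
    (hle : G ≤ SOLine η p) (hconn : IsConnectedLieSubgroup G) :
    IsWeaklyIrreducible η G ↔ IsTransitiveOnBoundary η p G := by
  refine ⟨fun hG => h.isTransitiveOnBoundary_iff.2 fun z hz z' hz' => ?_,
    fun hG => hG.isWeaklyIrreducible h hle hdim⟩
  obtain ⟨g, hg, hgz⟩ := hG.exists_apply_eq h hle hconn hz hz'
  exact ⟨g, hg, by rw [hgz]⟩

end Minkowski

theorem theorem4 {V : Type*} [NormedAddCommGroup V] [NormedSpace ℝ V]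
    (n : ℕ) (hn : 1 ≤ n)
    (η : LinearMap.BilinForm ℝ V) (hη : Minkowski.IsMinkowski η n)
    (p q : V) (hp : η p p = 0) (hq : η q q = 0) (hpq : η p q = 1)
    (G : Subgroup (V ≃ₗ[ℝ] V)) (hG : G < Minkowski.SOLine η p)
    (hconn : Minkowski.IsConnectedLieSubgroup G) :
    (Minkowski.IsWeaklyIrreducible η G ↔ Minkowski.IsTransitiveOnBoundary η p G) ∧
    (Minkowski.IsWeaklyIrreducible η G ↔ Minkowski.IsTransitiveOnEuclid η p q G) := by
  have hnull := hη.isNullPair hp hq hpq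
  obtain ⟨e, -⟩ := hη
  have : FiniteDimensional ℝ V := e.finiteDimensional_of_finite
  have hdim : 3 ≤ finrank ℝ V := by
    rw [finrank_eq_card_basis e, Fintype.card_fin]
    omega
  have hboundary :=
    Minkowski.isWeaklyIrreducible_iff_isTransitiveOnBoundary hnull hdim hG.le hconn
  exact ⟨hboundary, hboundary.trans hnull.isTransitiveOnBoundary_iff_isTransitiveOnEuclid⟩
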